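/- **Setting.** Let $G=(V,E)$ be a finite simple graph without isolated vertices, $V\neq\varnothing$, and let $\alpha>1$. For $\vec v$ in the simplex $\Delta_E=\{\vec v\in\mathbb{R}^E: v_e\ge 0,\ \sum_{e}v_e=1\}$ put $$F(\vec v)_e=-v_e+\frac1{|V|}\sum_{x\in e}\frac{v_e^{\alpha}}{\sum_{e'\ni x}v_{e'}^{\alpha}},\qquad e\in E .$$ A vector $\vec v\in\Delta_E$ with $F(\vec v)=\vec 0$ is an *equilibrium* on $G$. It is *linearly stable* if all eigenvalues of the matrix of partial derivatives of $F$ at $\vec v$ have negative real part, *linearly unstable* if some eigenvalue has positive real part, and *critical* otherwise. The $(r,r)$-whisker graph ($r\ge1$) consists of one distinguished edge with $r$ leaves attached to each of its two endpoints; $((v)_r,u,(v)_r)$ denotes the vector with value $u$ on the distinguished edge and $v$ on the $2r$ leaf edges. A *symmetric whisker-forest* on $G$ is a collection $\mathbf{G}=\{G_1,\dots,G_k\}$ of pairwise vertex-disjoint connected subgraphs of $G$, with at least two vertices each, which together cover $V$, such that each $G_j$ is a star with at least one edge or an $(r_j,r_j)$-whisker graph for some $r_j\ge 1$. It *admits a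 $(G,\alpha)$-stable allocation* if there is an equilibrium $\vec v$ on $G$, linearly stable or critical, with $v_e>0$ for every edge $e$ belonging to some $G_j$ and $v_e=0$ for every other edge $e$ of $G$. **Theorem.** (1) For every integer $r\ge 1$ the equation $$(\alpha-1)\ln(2(\alpha-1))-\alpha\ln\alpha=\ln\frac{1+r}{2}$$ has exactly one solution $\alpha=\alpha(r)$ in $(1,\infty)$, and it satisfies $\left[2\left(1-\frac1{\alpha}\right)\right]^{\alpha-1}=\frac{\alpha}{2}(r+1)$. On the $(r,r)$-whisker graph the following holds. For every $\alpha>\alpha(r)$ there are exactly two equilibria of the form $((v)_r,u,(v)_r)$ with $u>0$; both have $v<u$, and exactly one of them is linearly stable. For the linearly stable one, $u=u(\alpha)$ is strictly increasing in $\alpha\in(\alpha(r),\infty)$ and $u(\alpha)\to\frac1{r+1}$ as $\alpha\to\infty$. For $1<\alpha<\alpha(r)$ there is no equilibrium of the form $((v)_r,u,(v)_r)$ with $u>0$. (2) Consequently, for every symmetric whisker graph $G$ (that is, an $(r,r)$-whisker graph for some $r\ge1$) there is $\alpha_G>1$ such that for every $\alpha>\alpha_G$ there is a linearly stable equilibrium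 on $G$; and for every finite non-empty graph $G$ and every symmetric whisker-forest $\mathbf{G}$ on $G$ there is a constant $\alpha_{\mathbf{G}}>1$ such that $\mathbf{G}$ admits a $(G,\alpha)$-stable allocation for every $\alpha>\alpha_{\mathbf{G}}$. -/

import Mathlib

open Filter Topology

noncomputable section

namespace WARM

/-! ### The reinforcement model with `W(x) = x ^ α` on a finite set `ι` of colours -/

open Classical in
/-- The vector field `F` of the model in which the subset `A` of colours is selected with
probability `p A`, and then colour `i ∈ A` is reinforced with probability proportional to
`v i ^ α`. -/
def drift {ι : Type*} [Fintype ι] (p : Finset ι → ℝ) (α : ℝ) (v : ι → ℝ) (i : ι) : ℝ :=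
  -v i + ∑ A : Finset ι with i ∈ A, p A * (v i ^ α / ∑ j ∈ A, v j ^ α)

open Classical in
/-- `drift` is the limit, as `t → ∞`, of the expression with weights `W(v i * t)`,
`W(x) = x ^ α`. -/
theorem tendsto_drift {ι : Type*} [Fintype ι] (p : Finset ι → ℝ) (α : ℝ) (v : ι → ℝ)
    (hv : ∀ j, 0 ≤ v j) (i : ι) :
    Tendsto (fun t : ℝ => -v i + ∑ A : Finset ι with i ∈ A,
      p A * ((v i * t) ^ α / ∑ j ∈ A, (v j * t) ^ α)) atTop (𝓝 (drift p α v i)) := by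
  refine tendsto_const_nhds.congr' ?_
  filter_upwards [eventually_gt_atTop (0 : ℝ)] with t ht
  have h : ∀ j, (v j * t) ^ α = v j ^ α * t ^ α := fun j => Real.mul_rpow (hv j) ht.le
  simp only [drift, h, ← Finset.sum_mul]
  congr 1
  refine Finset.sum_congr rfl fun A _ => ?_
  rw [mul_div_mul_right _ _ (Real.rpow_pos_of_pos ht α).ne']

/-- Equilibrium distributions: points of the simplex at which `F` vanishes. -/
def IsEquilibrium {ι : Type*} [Fintype ι] (p : Finset ι → ℝ) (α : ℝ) (v : ι → ℝ) : Prop :=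
  v ∈ stdSimplex ℝ ι ∧ ∀ i, drift p α v i = 0

open Classical in
/-- All partial derivatives `∂ f_i / ∂ v_k` exist at `v`, and `D` is the matrix they form. -/
def HasJacobian {ι : Type*} (f : (ι → ℝ) → ι → ℝ) (D : Matrix ι ι ℝ) (v : ι → ℝ) : Prop :=
  ∀ i k, HasDerivAt (fun x : ℝ => f (Function.update v k x) i) (D i k) (v k)

/-- `μ` is a complex eigenvalue of the real matrix `D`. -/
def IsEigenvalue {ι : Type*} [Fintype ι] (D : Matrix ι ι ℝ) (μ : ℂ) : Prop :=
  Module.End.HasEigenvalue (Matrix.mulVecLin (D.map (fun x : ℝ => (x : ℂ)))) μ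

/-- Linearly stable: all eigenvalues of the matrix of partial derivatives of `F` have negative
real part. -/
def IsLinearlyStable {ι : Type*} [Fintype ι] (p : Finset ι → ℝ) (α : ℝ) (v : ι → ℝ) : Prop :=
  IsEquilibrium p α v ∧ ∃ D : Matrix ι ι ℝ, HasJacobian (drift p α) D v ∧
    ∀ μ : ℂ, IsEigenvalue D μ → μ.re < 0

/-- Critical: neither linearly stable nor linearly unstable, i.e. no eigenvalue has positive real
part, but not all of them have negative real part. -/
def IsCritical {ι : Type*} [Fintype ι] (p : Finset ι → ℝ) (α : ℝ) (v : ι → ℝ) : Prop :=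
  IsEquilibrium p α v ∧ ∃ D : Matrix ι ι ℝ, HasJacobian (drift p α) D v ∧
    (¬ ∃ μ : ℂ, IsEigenvalue D μ ∧ 0 < μ.re) ∧ ¬ ∀ μ : ℂ, IsEigenvalue D μ → μ.re < 0

/-! ### Graphs: the colours are the edges, and a uniform vertex selects its incident edges -/

open Classical in
/-- The set of edges of `G` incident to the vertex `x`. -/
def incidentEdges {V : Type*} [Fintype V] (G : SimpleGraph V) (x : V) : Finset G.edgeSet :=
  Finset.univ.filter fun e => x ∈ (e : Sym2 V)

open Classical in
/-- The probability that the set of edges incident to a uniformly chosen vertex is `A`. -/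
def graphLaw {V : Type*} [Fintype V] (G : SimpleGraph V) (A : Finset G.edgeSet) : ℝ :=
  ((Finset.univ.filter fun x : V => incidentEdges G x = A).card : ℝ) / Fintype.card V

open Classical in
/-- The set `(𝓔_α)_G` of equilibria on the graph `G`. -/
def equilibria {V : Type*} [Fintype V] (G : SimpleGraph V) (α : ℝ) : Set (G.edgeSet → ℝ) :=
  {v | IsEquilibrium (graphLaw G) α v}

open Classical in
/-- The set `(𝓢_α)_G` of linearly stable equilibria on the graph `G`. -/
def stableEquilibria {V : Type*} [Fintype V] (G : SimpleGraph V) (α : ℝ) :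
    Set (G.edgeSet → ℝ) :=
  {v | IsLinearlyStable (graphLaw G) α v}

open Classical in
/-- The set of critical equilibria on the graph `G`. -/
def criticalEquilibria {V : Type*} [Fintype V] (G : SimpleGraph V) (α : ℝ) :
    Set (G.edgeSet → ℝ) :=
  {v | IsCritical (graphLaw G) α v}

/-! ### Star graphs and whisker graphs -/

/-- The `(r, s)`-whisker graph: an edge joining the two centres `inl false` and `inl true`,
`r` leaves attached to the first centre and `s` leaves attached to the second one. -/
def whiskerGraph (r s : ℕ) : SimpleGraph (Bool ⊕ (Fin r ⊕ Fin s)) :=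
  SimpleGraph.fromRel fun x y =>
    match x, y with
    | Sum.inl false, Sum.inl true => True
    | Sum.inl false, Sum.inr (Sum.inl _) => True
    | Sum.inl true, Sum.inr (Sum.inr _) => True
    | _, _ => False

/-- `H` is a star graph with at least one edge. -/
def IsStar {W : Type*} (H : SimpleGraph W) : Prop :=
  ∃ m : ℕ, 1 ≤ m ∧ Nonempty (completeBipartiteGraph Unit (Fin m) ≃g H)

/-- `H` is a copy of the symmetric `(r, r)`-whisker graph for some `r ≥ 1`. -/
def IsSymmetricWhisker {W : Type*} (H : SimpleGraph W) : Prop :=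
  ∃ r : ℕ, 1 ≤ r ∧ Nonempty (whiskerGraph r r ≃g H)

/-- The vector `((v)_r, u, (v)_r)`: value `u` on the edge joining the two centres and `v` on all
other edges. -/
def whiskerVector (r : ℕ) (v u : ℝ) (e : (whiskerGraph r r).edgeSet) : ℝ :=
  if (e : Sym2 (Bool ⊕ (Fin r ⊕ Fin r))) = s(Sum.inl false, Sum.inl true) then u else v

/-- The function `g(α) = (α - 1) log (2 (α - 1)) - α log α`, meant for `α > 1`. -/
def thresholdFun (α : ℝ) : ℝ :=
  (α - 1) * Real.log (2 * (α - 1)) - α * Real.log α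

/-! ### Spanning collections of connected clusters and stable allocations -/

/-- `H 0, …, H (k - 1)` are vertex-disjoint connected subgraphs of `G` with at least two vertices
each, which together cover all vertices of `G`. -/
def IsClusterCollection {V : Type*} [Fintype V] (G : SimpleGraph V) {k : ℕ}
    (H : Fin k → G.Subgraph) : Prop :=
  2 * k ≤ Fintype.card V ∧ (∀ j, (H j).Connected) ∧ (∀ j, 2 ≤ (H j).verts.ncard) ∧
    (⋃ j, (H j).verts) = Set.univ ∧
    ∀ i j, i ≠ j → Disjoint (H i).verts (H j).verts

/-- A symmetric whisker-forest on `G`: every component is a star graph or a symmetric whisker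
graph. -/
def IsSymmetricWhiskerForest {V : Type*} [Fintype V] (G : SimpleGraph V) {k : ℕ}
    (H : Fin k → G.Subgraph) : Prop :=
  IsClusterCollection G H ∧ ∀ j, IsStar (H j).coe ∨ IsSymmetricWhisker (H j).coe

/-- The collection `H` admits a `(G, α)`-stable allocation: there is a linearly stable or critical
equilibrium on `G` that is positive on the edges of the clusters and zero on all other edges. -/
def AdmitsStableAllocation {V : Type*} [Fintype V] (G : SimpleGraph V) (α : ℝ) {k : ℕ}
    (H : Fin k → G.Subgraph) : Prop :=
  ∃ v : G.edgeSet → ℝ,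
    (∀ e : G.edgeSet, (∃ j, (e : Sym2 V) ∈ (H j).edgeSet) → 0 < v e) ∧
    (∀ e : G.edgeSet, (¬ ∃ j, (e : Sym2 V) ∈ (H j).edgeSet) → v e = 0) ∧
    (v ∈ stableEquilibria G α ∨ v ∈ criticalEquilibria G α)

end WARM

end

/-!
For selection by a set-valued map `inc`, the linearization of the drift at an equilibrium `v` is
`A - 1`, where `A` satisfies `⟨y, A (v · y)⟩ = α / |V| * ∑ x, Var_x y`; here `Var_x` is the variance
under the selection probabilities at `x`. Hence the real parts of the eigenvalues of `A` are bounded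
by `θ` as soon as `α * ∑ x, Var_x y ≤ θ * |V| * ∑ e, v e * y e ^ 2` for all real `y`.

On the `(r, r)`-whisker graph the equilibria `((v)_r, u, (v)_r)` correspond to the positive zeros
`t = v / u` of `(r + 1) * t ^ α - 2 * t + 1`. This function of `t` first decreases and then
increases, and the sign of its minimum is decided by comparing `g(α)` with `log ((r + 1) / 2)`. The
variance inequality holds with the sharp constant `θ = α * (r + 1) * p / (1 + p)`, where `p` is the
selection probability of a leaf edge at a centre, and `θ < 1` says exactly that `t` lies to the left
of the minimum. This smaller zero decreases to `1 / 2` as `α → ∞`.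

On a forest one solves the equilibrium equations of the whole graph on each cluster separately. For
large `α` every vertex then selects one edge with probability at least `1 - α⁻²`, so that all
variances are `O(α⁻²)` and the factor `α` does no harm. A star is treated as a whisker graph without
leaves at the second centre.
-/

noncomputable section

namespace WARM

open Classical

/-! ### Spectra of linearized drifts -/

section Spectrum

variable {E : Type*}

theorem HasJacobian.unique {f : (E → ℝ) → E → ℝ} {D D' : Matrix E E ℝ} {v : E → ℝ}
    (h : HasJacobian f D v) (h' : HasJacobian f D' v) : D = D' := by
  ext i k
  exact (h i k).unique (h' i k)

variable [Fintype E] {B : Matrix E E ℝ}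

theorem IsEigenvalue.exists_re_im {μ : ℂ} (h : IsEigenvalue B μ) :
    ∃ a b : E → ℝ, (∃ e, a e ≠ 0 ∨ b e ≠ 0) ∧
      (∀ e, B.mulVec a e = μ.re * a e - μ.im * b e) ∧
      ∀ e, B.mulVec b e = μ.re * b e + μ.im * a e := by
  obtain ⟨w, hw⟩ := h.exists_hasEigenvector
  have hmul := hw.apply_eq_smul
  refine ⟨fun e => (w e).re, fun e => (w e).im, ?_, fun e => ?_, fun e => ?_⟩
  · obtain ⟨e, he⟩ := Function.ne_iff.mp hw.2
    refine ⟨e, ?_⟩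
    by_contra! h0
    exact he (Complex.ext h0.1 h0.2)
  · simpa [Matrix.mulVec, dotProduct] using congrArg Complex.re (congrFun hmul e)
  · simpa [Matrix.mulVec, dotProduct] using congrArg Complex.im (congrFun hmul e)

theorem isEigenvalue_of_mulVec {μ : ℝ} {w : E → ℝ} (hw : w ≠ 0)
    (h : ∀ e, B.mulVec w e = μ * w e) : IsEigenvalue B (μ : ℂ) := by
  refine Module.End.hasEigenvalue_of_hasEigenvector (x := fun e => (w e : ℂ))
    ⟨Module.End.mem_eigenspace_iff.mpr ?_, ?_⟩
  · ext e
    simpa [Matrix.mulVec, dotProduct] using congrArg (fun x : ℝ => (x : ℂ)) (h e)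
  · obtain ⟨e, he⟩ := Function.ne_iff.mp hw
    exact Function.ne_iff.mpr ⟨e, by simpa using he⟩

theorem isEigenvalue_sub_one_iff {μ : ℂ} : IsEigenvalue (B - 1) μ ↔ IsEigenvalue B (μ + 1) := by
  have hmap : (B - 1).map (fun x : ℝ => (x : ℂ)) = B.map (fun x : ℝ => (x : ℂ)) - 1 := by
    ext i j
    by_cases h : i = j <;> simp [h]
  have hshift : ∀ M : Matrix E E ℂ, (M - 1).mulVecLin - μ • 1 = M.mulVecLin - (μ + 1) • 1 := by
    intro M
    refine LinearMap.ext fun w => ?_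
    simp [add_smul, sub_sub, add_comm]
  rw [IsEigenvalue, IsEigenvalue, Module.End.hasEigenvalue_iff, Module.End.hasEigenvalue_iff,
    Module.End.eigenspace_def, Module.End.eigenspace_def, hmap, hshift]

theorem IsEigenvalue.exists_re_im_mul {v : E → ℝ} {μ : ℂ}
    (hrow : ∀ e, v e = 0 → ∀ f, B e f = 0) (hμ0 : μ ≠ 0) (hμ : IsEigenvalue B μ) :
    ∃ y z : E → ℝ, (∃ e, v e * y e ≠ 0 ∨ v e * z e ≠ 0) ∧
      (∀ e, B.mulVec (fun f => v f * y f) e = μ.re * (v e * y e) - μ.im * (v e * z e)) ∧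
      ∀ e, B.mulVec (fun f => v f * z f) e = μ.re * (v e * z e) + μ.im * (v e * y e) := by
  obtain ⟨a, b, hne, ha, hb⟩ := hμ.exists_re_im
  have hnorm : μ.re ^ 2 + μ.im ^ 2 ≠ 0 := by
    simpa [Complex.normSq_apply, sq] using (Complex.normSq_pos.mpr hμ0).ne'
  have hzero : ∀ e, v e = 0 → a e = 0 ∧ b e = 0 := by
    intro e he
    have ha' : μ.re * a e - μ.im * b e = 0 := by
      rw [← ha]; simp [Matrix.mulVec, dotProduct, hrow e he]
    have hb' : μ.re * b e + μ.im * a e = 0 := by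
      rw [← hb]; simp [Matrix.mulVec, dotProduct, hrow e he]
    constructor
    · refine (mul_eq_zero.mp ?_).resolve_left hnorm
      linear_combination μ.re * ha' + μ.im * hb'
    · refine (mul_eq_zero.mp ?_).resolve_left hnorm
      linear_combination μ.re * hb' - μ.im * ha'
  have hdiv : ∀ c : E → ℝ, (∀ e, v e = 0 → c e = 0) → ∃ y : E → ℝ, c = fun e => v e * y e :=
    fun c hc => ⟨fun e => c e / v e, funext fun e => by
      rcases eq_or_ne (v e) 0 with he | he
      · simp [he, hc e he]
      · field_simp⟩
  obtain ⟨y, rfl⟩ := hdiv a fun e he => (hzero e he).1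
  obtain ⟨z, rfl⟩ := hdiv b fun e he => (hzero e he).2
  exact ⟨y, z, hne, ha, hb⟩

theorem IsEigenvalue.re_le_of_quadForm_le {v : E → ℝ} {θ : ℝ} {μ : ℂ} (hv : ∀ e, 0 ≤ v e)
    (hrow : ∀ e, v e = 0 → ∀ f, B e f = 0) (hθ : 0 ≤ θ)
    (hB : ∀ y : E → ℝ, ∑ e, y e * B.mulVec (fun f => v f * y f) e ≤ θ * ∑ e, v e * y e ^ 2)
    (hμ : IsEigenvalue B μ) : μ.re ≤ θ := by
  rcases eq_or_ne μ 0 with rfl | hμ0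
  · simpa using hθ
  obtain ⟨y, z, ⟨e₀, h₀⟩, hy, hz⟩ := hμ.exists_re_im_mul hrow hμ0
  -- The cross terms carrying `μ.im` cancel in the sum of the two quadratic forms.
  have hform : ∑ e, y e * B.mulVec (fun f => v f * y f) e +
      ∑ e, z e * B.mulVec (fun f => v f * z f) e =
        μ.re * (∑ e, v e * y e ^ 2 + ∑ e, v e * z e ^ 2) := by
    rw [← Finset.sum_add_distrib, ← Finset.sum_add_distrib, Finset.mul_sum]
    refine Finset.sum_congr rfl fun e _ => ?_
    rw [hy, hz]
    ring
  have hpos : 0 < ∑ e, v e * y e ^ 2 + ∑ e, v e * z e ^ 2 := by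
    rw [← Finset.sum_add_distrib]
    simp only [← mul_add]
    refine Finset.sum_pos' (fun e _ => mul_nonneg (hv e) (by positivity))
      ⟨e₀, Finset.mem_univ _, ?_⟩
    simp only [ne_eq, mul_eq_zero, not_or] at h₀
    rcases h₀ with ⟨hve, hne⟩ | ⟨hve, hne⟩ <;>
      exact mul_pos ((hv e₀).lt_of_ne' hve) (by positivity)
  refine le_of_mul_le_mul_right ?_ hpos
  linarith [hB y, hB z]

end Spectrum

section Incidence

variable {V E : Type*}

/-- The total weight of the set `inc x` of colours that the vertex `x` selects. -/
def weightSum (inc : V → Finset E) (α : ℝ) (v : E → ℝ) (x : V) : ℝ :=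
  ∑ f ∈ inc x, v f ^ α

/-- The probability that the colour `e` is reinforced when the vertex `x` is drawn; it vanishes
for every `e` when the total weight at `x` is zero. -/
def selProb (inc : V → Finset E) (α : ℝ) (v : E → ℝ) (x : V) (e : E) : ℝ :=
  if e ∈ inc x then v e ^ α / weightSum inc α v x else 0

variable {inc : V → Finset E} {α : ℝ} {v : E → ℝ}

theorem selProb_nonneg (hv : ∀ e, 0 ≤ v e) (x : V) (e : E) : 0 ≤ selProb inc α v x e := by
  unfold selProb weightSum
  split_ifs
  · exact div_nonneg (Real.rpow_nonneg (hv e) α)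
      (Finset.sum_nonneg fun f _ => Real.rpow_nonneg (hv f) α)
  · exact le_rfl

theorem selProb_eq_zero (hα : α ≠ 0) {e : E} (he : v e = 0) (x : V) :
    selProb inc α v x e = 0 := by
  simp [selProb, he, Real.zero_rpow hα]

theorem hasDerivAt_update_rpow (hα : 1 ≤ α) (e k : E) :
    HasDerivAt (fun t : ℝ => Function.update v k t e ^ α)
      (if e = k then α * v k ^ (α - 1) else 0) (v k) := by
  by_cases h : e = k
  · subst h
    simpa using Real.hasDerivAt_rpow_const (x := v e) (p := α) (Or.inr hα)
  · simpa [h] using hasDerivAt_const (v k) (v e ^ α)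

theorem hasDerivAt_update_weightSum (hα : 1 ≤ α) (x : V) (k : E) :
    HasDerivAt (fun t : ℝ => weightSum inc α (Function.update v k t) x)
      (if k ∈ inc x then α * v k ^ (α - 1) else 0) (v k) := by
  simpa [weightSum] using
    HasDerivAt.fun_sum (u := inc x) fun f _ => hasDerivAt_update_rpow (v := v) hα f k

theorem hasDerivAt_update_selProb (hα : 1 ≤ α) {x : V} (hS : weightSum inc α v x ≠ 0) (e k : E) :
    HasDerivAt (fun t : ℝ => selProb inc α (Function.update v k t) x e)
      (if k ∈ inc x then α * v k ^ (α - 1) / weightSum inc α v x *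
        ((if e = k then 1 else 0) - selProb inc α v x e) else 0) (v k) := by
  by_cases he : e ∈ inc x
  · have hquot := (hasDerivAt_update_rpow (v := v) hα e k).fun_div
      (hasDerivAt_update_weightSum hα x k) (by simpa using hS)
    simp only [Function.update_eq_self] at hquot
    simp only [selProb, he, if_true]
    refine hquot.congr_deriv ?_
    rcases eq_or_ne e k with rfl | hek
    · simp only [he, if_true]
      field_simp
    · simp only [hek, if_false]
      split_ifs
      · field_simp
        ring
      · simp
  · have hek : k ∈ inc x → e ≠ k := fun hk hek => he (hek ▸ hk)
    simp only [selProb, he, if_false]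
    refine (hasDerivAt_const (v k) (0 : ℝ)).congr_deriv ?_
    split_ifs with hk h
    · exact absurd h (hek hk)
    · simp
    · rfl

/-- The matrix of partial derivatives of the gain `e ↦ (∑ x, selProb inc α v x e) / card V`; the
matrix of partial derivatives of the drift is `gainMatrix inc α v - 1`. -/
def gainMatrix [Fintype V] (inc : V → Finset E) (α : ℝ) (v : E → ℝ) : Matrix E E ℝ := fun e f =>
  (∑ x, if f ∈ inc x then α * v f ^ (α - 1) / weightSum inc α v x *
    ((if e = f then 1 else 0) - selProb inc α v x e) else 0) / Fintype.card V

theorem gainMatrix_eq_zero [Fintype V] (hα : 1 < α) {e : E} (he : v e = 0) (f : E) :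
    gainMatrix inc α v e f = 0 := by
  have hsel := selProb_eq_zero (inc := inc) (by linarith : α ≠ 0) he
  rcases eq_or_ne e f with rfl | hef
  · simp [gainMatrix, he, Real.zero_rpow (sub_pos.mpr hα).ne']
  · simp [gainMatrix, hsel, hef]

variable [Fintype E]

/-- The mean of `y` under the weights `selProb inc α v x`. -/
def selMean (inc : V → Finset E) (α : ℝ) (v : E → ℝ) (x : V) (y : E → ℝ) : ℝ :=
  ∑ f, selProb inc α v x f * y f

/-- The variance of `y` under the weights `selProb inc α v x`. -/
def selVar (inc : V → Finset E) (α : ℝ) (v : E → ℝ) (x : V) (y : E → ℝ) : ℝ :=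
  selMean inc α v x (fun f => y f ^ 2) - selMean inc α v x y ^ 2

theorem sum_selProb (x : V) :
    ∑ e, selProb inc α v x e = weightSum inc α v x / weightSum inc α v x := by
  simp [selProb, weightSum, Finset.sum_div]

theorem sum_selProb_mul_mul_sub_selMean (x : V) (y : E → ℝ) :
    ∑ e, y e * (selProb inc α v x e * (y e - selMean inc α v x y)) = selVar inc α v x y := by
  rw [selVar, selMean, sq, selMean, Finset.sum_mul, ← Finset.sum_sub_distrib]
  exact Finset.sum_congr rfl fun e _ => by ring

theorem selVar_le_sum_sq_sub {x : V} (hS : weightSum inc α v x ≠ 0) (y : E → ℝ) (c : ℝ) :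
    selVar inc α v x y ≤ ∑ f, selProb inc α v x f * (y f - c) ^ 2 := by
  have hexp : ∑ f, selProb inc α v x f * (y f - c) ^ 2 =
      selMean inc α v x (fun f => y f ^ 2) - 2 * c * selMean inc α v x y + c ^ 2 := by
    have hterm : ∀ f, selProb inc α v x f * (y f - c) ^ 2 = selProb inc α v x f * y f ^ 2
        - 2 * c * (selProb inc α v x f * y f) + selProb inc α v x f * c ^ 2 := fun f => by ring
    simp only [hterm, Finset.sum_add_distrib, Finset.sum_sub_distrib, ← Finset.mul_sum,
      ← Finset.sum_mul, sum_selProb, div_self hS, selMean, one_mul]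
  rw [hexp, selVar]
  linarith [sq_nonneg (selMean inc α v x y - c)]

variable [Fintype V]

/-- The law of the set `inc x` for a uniformly chosen vertex `x`. -/
def incLaw (inc : V → Finset E) (A : Finset E) : ℝ :=
  ((Finset.univ.filter fun x : V => inc x = A).card : ℝ) / Fintype.card V

theorem drift_incLaw (e : E) :
    drift (incLaw inc) α v e = -v e + (∑ x, selProb inc α v x e) / Fintype.card V := by
  unfold drift incLaw
  congr 1
  have hcard : ∀ A : Finset E, ((Finset.univ.filter fun x : V => inc x = A).card : ℝ)
      = ∑ x : V, if inc x = A then 1 else 0 := fun A => by simp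
  simp only [hcard, Finset.sum_div, Finset.sum_mul]
  rw [Finset.sum_comm]
  refine Finset.sum_congr rfl fun x _ => ?_
  rw [Finset.sum_filter, Finset.sum_eq_single (inc x)]
  · unfold selProb weightSum
    by_cases he : e ∈ inc x <;> simp [he, div_eq_inv_mul]
  · intro A _ hA
    simp [hA.symm]
  · simp

theorem IsEquilibrium.card_mul_eq (h : IsEquilibrium (incLaw inc) α v) (e : E) :
    Fintype.card V * v e = ∑ x, selProb inc α v x e := by
  rcases isEmpty_or_nonempty V with hV | hV
  · simp
  · have hdrift := h.2 e
    rw [drift_incLaw, neg_add_eq_zero] at hdrift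
    rw [hdrift]
    field_simp

/-- Every vertex with nonzero total weight contributes mass `1 / card V`, so a vertex of total
weight zero would leave total mass below `1`. -/
theorem IsEquilibrium.weightSum_ne_zero (h : IsEquilibrium (incLaw inc) α v) (x : V) :
    weightSum inc α v x ≠ 0 := by
  intro hx
  have hsum : ∑ x, weightSum inc α v x / weightSum inc α v x = Fintype.card V := by
    calc ∑ x, weightSum inc α v x / weightSum inc α v x = ∑ e, ∑ x, selProb inc α v x e := by
          rw [Finset.sum_comm]; simp only [sum_selProb]
      _ = Fintype.card V * ∑ e, v e := by simp only [← h.card_mul_eq, Finset.mul_sum]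
      _ = Fintype.card V := by rw [h.1.2, mul_one]
  have hlt : ∑ x, weightSum inc α v x / weightSum inc α v x < ∑ _x : V, (1 : ℝ) :=
    Finset.sum_lt_sum (fun x _ => div_self_le_one _) ⟨x, Finset.mem_univ x, by simp [hx]⟩
  simp [hsum] at hlt

theorem isEquilibrium_incLaw_iff [Nonempty V] :
    IsEquilibrium (incLaw inc) α v ↔ (∀ e, 0 ≤ v e) ∧ (∀ x, weightSum inc α v x ≠ 0) ∧
      ∀ e, Fintype.card V * v e = ∑ x, selProb inc α v x e := by
  refine ⟨fun h => ⟨h.1.1, h.weightSum_ne_zero, h.card_mul_eq⟩, fun ⟨hv, hS, hbal⟩ =>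
    ⟨⟨hv, ?_⟩, fun e => ?_⟩⟩
  · have hn : (Fintype.card V : ℝ) ≠ 0 := by positivity
    refine mul_left_cancel₀ hn ?_
    rw [Finset.mul_sum, Finset.sum_congr rfl fun e _ => hbal e, Finset.sum_comm]
    simp [sum_selProb, hS]
  · rw [drift_incLaw, ← hbal e]
    field_simp
    ring

theorem hasJacobian_gainMatrix_sub_one (hα : 1 ≤ α) (hS : ∀ x, weightSum inc α v x ≠ 0) :
    HasJacobian (drift (incLaw inc) α) (gainMatrix inc α v - 1) v := by
  intro e k
  have hid : HasDerivAt (fun t : ℝ => Function.update v k t e) ((1 : Matrix E E ℝ) e k) (v k) := by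
    rcases eq_or_ne e k with rfl | h
    · simpa using hasDerivAt_id' (v e)
    · simpa [h] using hasDerivAt_const (v k) (v e)
  have hgain := (HasDerivAt.fun_sum (u := Finset.univ) fun x _ =>
    hasDerivAt_update_selProb hα (hS x) e k).div_const (Fintype.card V : ℝ)
  simp only [drift_incLaw]
  rw [Matrix.sub_apply, sub_eq_neg_add]
  exact hid.fun_neg.fun_add hgain

theorem gainMatrix_mulVec_mul (hα : 1 < α) (hv : ∀ e, 0 ≤ v e) (y : E → ℝ) (e : E) :
    (gainMatrix inc α v).mulVec (fun f => v f * y f) e =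
      α / Fintype.card V * ∑ x, selProb inc α v x e * (y e - selMean inc α v x y) := by
  have hpow : ∀ f, v f ^ (α - 1) * v f = v f ^ α := fun f => by
    rw [← Real.rpow_add_one' (hv f) (by linarith), sub_add_cancel]
  have hterm : ∀ x f, (if f ∈ inc x then α * v f ^ (α - 1) / weightSum inc α v x *
      ((if e = f then 1 else 0) - selProb inc α v x e) else 0) * (v f * y f) =
      α * ((if e = f then selProb inc α v x e * y e else 0) -
        selProb inc α v x e * (selProb inc α v x f * y f)) := by
    intro x f
    have hf : selProb inc α v x f = if f ∈ inc x then v f ^ (α - 1) * v f /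
        weightSum inc α v x else 0 := by rw [hpow]; rfl
    rcases eq_or_ne e f with rfl | hef
    · rw [hf]; simp only [if_true]; split_ifs <;> ring
    · rw [hf]; simp only [hef, if_false]; split_ifs <;> ring
  simp only [Matrix.mulVec, dotProduct, gainMatrix, div_mul_eq_mul_div _ (Fintype.card V : ℝ),
    Finset.sum_mul]
  rw [← Finset.sum_div, Finset.sum_comm, Finset.mul_sum]
  congr 1
  refine Finset.sum_congr rfl fun x _ => ?_
  calc _ = ∑ f, α * ((if e = f then selProb inc α v x e * y e else 0) -
        selProb inc α v x e * (selProb inc α v x f * y f)) :=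
        Finset.sum_congr rfl fun f _ => hterm x f
    _ = _ := by simp [← Finset.mul_sum, selMean, mul_sub]

theorem sum_mul_gainMatrix_mulVec (hα : 1 < α) (hv : ∀ e, 0 ≤ v e) (y : E → ℝ) :
    ∑ e, y e * (gainMatrix inc α v).mulVec (fun f => v f * y f) e =
      α / Fintype.card V * ∑ x, selVar inc α v x y := by
  simp only [gainMatrix_mulVec_mul hα hv, ← sum_selProb_mul_mul_sub_selMean]
  simp only [Finset.mul_sum]
  rw [Finset.sum_comm]
  exact Finset.sum_congr rfl fun x _ => Finset.sum_congr rfl fun e _ => by ring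

theorem isLinearlyStable_incLaw_iff (hα : 1 < α) :
    IsLinearlyStable (incLaw inc) α v ↔ IsEquilibrium (incLaw inc) α v ∧
      ∀ μ : ℂ, IsEigenvalue (gainMatrix inc α v) μ → μ.re < 1 := by
  refine and_congr_right fun heq => ?_
  have hJ := hasJacobian_gainMatrix_sub_one hα.le heq.weightSum_ne_zero
  constructor
  · rintro ⟨D, hD, hneg⟩ μ hμ
    rw [hD.unique hJ] at hneg
    simpa using hneg (μ - 1) (isEigenvalue_sub_one_iff.mpr (by simpa using hμ))
  · refine fun hlt => ⟨_, hJ, fun μ hμ => ?_⟩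
    simpa using hlt (μ + 1) (isEigenvalue_sub_one_iff.mp hμ)

theorem isLinearlyStable_of_selVar_le {θ : ℝ} (hα : 1 < α) (hθ : 0 ≤ θ) (hθ1 : θ < 1)
    (heq : IsEquilibrium (incLaw inc) α v)
    (hvar : ∀ y : E → ℝ,
      α * ∑ x, selVar inc α v x y ≤ θ * (Fintype.card V * ∑ e, v e * y e ^ 2)) :
    IsLinearlyStable (incLaw inc) α v := by
  refine (isLinearlyStable_incLaw_iff hα).mpr ⟨heq, fun μ hμ => ?_⟩
  have hv : ∀ e, 0 ≤ v e := heq.1.1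
  refine lt_of_le_of_lt (hμ.re_le_of_quadForm_le hv
    (fun e he => gainMatrix_eq_zero hα he) hθ fun y => ?_) hθ1
  rw [sum_mul_gainMatrix_mulVec hα hv]
  rcases isEmpty_or_nonempty V with hV | hV
  · simpa using mul_nonneg hθ (Finset.sum_nonneg fun e _ => mul_nonneg (hv e) (sq_nonneg (y e)))
  · rw [div_mul_eq_mul_div, div_le_iff₀ (by positivity)]
    linarith [hvar y]

theorem sq_le_card_mul_sum (hv : ∀ e, 0 ≤ v e) {e : E} (he : 1 ≤ Fintype.card V * v e)
    (y : E → ℝ) : y e ^ 2 ≤ Fintype.card V * ∑ f, v f * y f ^ 2 := by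
  calc y e ^ 2 ≤ Fintype.card V * v e * y e ^ 2 := le_mul_of_one_le_left (sq_nonneg _) he
    _ = Fintype.card V * (v e * y e ^ 2) := mul_assoc _ _ _
    _ ≤ _ := mul_le_mul_of_nonneg_left (Finset.single_le_sum (f := fun f => v f * y f ^ 2)
        (fun f _ => mul_nonneg (hv f) (sq_nonneg _)) (Finset.mem_univ e)) (Nat.cast_nonneg _)

theorem selVar_le_of_le_selProb {ε : ℝ} (hα : α ≠ 0) (hv : ∀ e, 0 ≤ v e)
    (hlow : ∀ e, v e ≠ 0 → 1 ≤ Fintype.card V * v e) {x : V} (hS : weightSum inc α v x ≠ 0)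
    {h : E} (hh : v h ≠ 0) (hdom : 1 - ε ≤ selProb inc α v x h) (y : E → ℝ) :
    selVar inc α v x y ≤ ε * (4 * (Fintype.card V * ∑ e, v e * y e ^ 2)) := by
  set A := (Fintype.card V : ℝ) * ∑ e, v e * y e ^ 2
  have hA : 0 ≤ A := mul_nonneg (Nat.cast_nonneg _)
    (Finset.sum_nonneg fun e _ => mul_nonneg (hv e) (sq_nonneg (y e)))
  have hterm : ∀ f, selProb inc α v x f * (y f - y h) ^ 2 ≤
      (selProb inc α v x f - if f = h then selProb inc α v x f else 0) * (4 * A) := by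
    intro f
    rcases eq_or_ne f h with rfl | hfh
    · simp
    rcases eq_or_ne (v f) 0 with hf | hf
    · simp [selProb_eq_zero hα hf]
    have hyf := sq_le_card_mul_sum hv (hlow f hf) y
    have hyh := sq_le_card_mul_sum hv (hlow h hh) y
    rw [if_neg hfh, sub_zero]
    exact mul_le_mul_of_nonneg_left (by nlinarith [sq_nonneg (y f + y h)]) (selProb_nonneg hv x f)
  calc selVar inc α v x y ≤ ∑ f, selProb inc α v x f * (y f - y h) ^ 2 :=
        selVar_le_sum_sq_sub hS y (y h)
    _ ≤ ∑ f, (selProb inc α v x f - if f = h then selProb inc α v x f else 0) * (4 * A) :=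
        Finset.sum_le_sum fun f _ => hterm f
    _ = (1 - selProb inc α v x h) * (4 * A) := by
        simp [← Finset.sum_mul, Finset.sum_sub_distrib, sum_selProb, div_self hS]
    _ ≤ ε * (4 * A) := mul_le_mul_of_nonneg_right (by linarith) (by positivity)

theorem isLinearlyStable_of_le_selProb {ε : ℝ} (hα : 1 < α) (hε : 0 ≤ ε)
    (hsmall : 4 * α * ε * Fintype.card V < 1) (heq : IsEquilibrium (incLaw inc) α v)
    (hlow : ∀ e, v e ≠ 0 → 1 ≤ Fintype.card V * v e)
    (hdom : ∀ x, ∃ h, v h ≠ 0 ∧ 1 - ε ≤ selProb inc α v x h) :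
    IsLinearlyStable (incLaw inc) α v := by
  refine isLinearlyStable_of_selVar_le hα (by positivity) hsmall heq fun y => ?_
  have hle : ∀ x, selVar inc α v x y ≤ ε * (4 * (Fintype.card V * ∑ e, v e * y e ^ 2)) :=
    fun x => (hdom x).elim fun h hh => selVar_le_of_le_selProb (by linarith) heq.1.1 hlow
      (heq.weightSum_ne_zero x) hh.1 hh.2 y
  calc α * ∑ x, selVar inc α v x y
      ≤ α * ∑ _x : V, ε * (4 * (Fintype.card V * ∑ e, v e * y e ^ 2)) :=
        mul_le_mul_of_nonneg_left (Finset.sum_le_sum fun x _ => hle x) (by linarith)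
    _ = _ := by
        rw [Finset.sum_const, Finset.card_univ, nsmul_eq_mul]
        ring

end Incidence

/-! ### Edge weights on graphs -/

section Graph

variable {V : Type*} [Fintype V]

/-- The total weight at the vertex `x`, for edge weights `w` that are given on all unordered pairs
and vanish off the edges of the graph under consideration. -/
def vertexWeight (α : ℝ) (w : Sym2 V → ℝ) (x : V) : ℝ :=
  ∑ y, w s(x, y) ^ α

variable {G : SimpleGraph V} {α : ℝ} {w : Sym2 V → ℝ}

theorem graphLaw_eq_incLaw (G : SimpleGraph V) : graphLaw G = incLaw (incidentEdges G) := by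
  ext A
  unfold graphLaw incLaw
  congr

theorem mem_incidentEdges {x : V} {e : G.edgeSet} :
    e ∈ incidentEdges G x ↔ x ∈ (e : Sym2 V) := by
  simp [incidentEdges]

theorem sum_incidentEdges {φ : Sym2 V → ℝ} (hφ : ∀ e ∉ G.edgeSet, φ e = 0) (x : V) :
    ∑ f ∈ incidentEdges G x, φ f = ∑ y, φ s(x, y) := by
  rw [← Finset.sum_filter_of_ne (p := G.Adj x) fun y _ hy => by_contra fun h => hy (hφ _ h)]
  symm
  refine Finset.sum_bij (fun y hy => ⟨s(x, y), by simpa using hy⟩) (fun y _ => ?_)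
    (fun y _ y' _ h => ?_) (fun f hf => ?_) fun y _ => rfl
  · simp [mem_incidentEdges]
  · exact Sym2.congr_right.mp (congrArg Subtype.val h)
  · obtain ⟨y, hy⟩ := Sym2.mem_iff_exists.mp (mem_incidentEdges.mp hf)
    have hadj : G.Adj x y := by
      rw [← SimpleGraph.mem_edgeSet, ← hy]
      exact f.2
    exact ⟨y, by simpa using hadj, Subtype.ext hy.symm⟩

theorem weightSum_incidentEdges (hα : α ≠ 0) (hw : ∀ e ∉ G.edgeSet, w e = 0) (x : V) :
    weightSum (incidentEdges G) α (fun e => w e) x = vertexWeight α w x :=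
  sum_incidentEdges (φ := fun e => w e ^ α)
    (fun e he => by simp only [hw e he, Real.zero_rpow hα]) x

theorem selProb_incidentEdges (hα : α ≠ 0) (hw : ∀ e ∉ G.edgeSet, w e = 0) {x y : V}
    (h : G.Adj x y) : selProb (incidentEdges G) α (fun e => w e) x ⟨s(x, y), h⟩ =
      w s(x, y) ^ α / vertexWeight α w x := by
  rw [selProb, if_pos (mem_incidentEdges.mpr (Sym2.mem_mk_left x y)),
    weightSum_incidentEdges hα hw]

theorem sum_selProb_edge (hα : α ≠ 0) (hw : ∀ e ∉ G.edgeSet, w e = 0) {x y : V} (h : G.Adj x y) :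
    ∑ z, selProb (incidentEdges G) α (fun e => w e) z ⟨s(x, y), h⟩ =
      w s(x, y) ^ α / vertexWeight α w x + w s(x, y) ^ α / vertexWeight α w y := by
  rw [Finset.sum_eq_add x y (G.ne_of_adj h) (fun z _ hz => by
    simp [selProb, mem_incidentEdges, hz.1, hz.2]) (by simp) (by simp)]
  simp [selProb, mem_incidentEdges, weightSum_incidentEdges hα hw]

theorem isEquilibrium_graphLaw_iff [Nonempty V] (hα : α ≠ 0) (hw : ∀ e ∉ G.edgeSet, w e = 0) :
    IsEquilibrium (graphLaw G) α (fun e => w e) ↔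
      (∀ e ∈ G.edgeSet, 0 ≤ w e) ∧ (∀ x, vertexWeight α w x ≠ 0) ∧
        ∀ x y, G.Adj x y → Fintype.card V * w s(x, y) =
          w s(x, y) ^ α / vertexWeight α w x + w s(x, y) ^ α / vertexWeight α w y := by
  simp only [graphLaw_eq_incLaw, isEquilibrium_incLaw_iff, weightSum_incidentEdges hα hw]
  refine and_congr Subtype.forall (and_congr_right' ⟨fun h x y hxy => ?_, fun h => ?_⟩)
  · rw [← sum_selProb_edge hα hw hxy]
    exact h ⟨_, hxy⟩
  · rintro ⟨⟨x, y⟩, hxy⟩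
    exact (h x y hxy).trans (sum_selProb_edge hα hw hxy).symm

end Graph

section Domination

/-- Edge weights on `K`, vanishing off `K`, that satisfy the equilibrium equations of a graph with
`n` vertices and such that at every non-isolated vertex of `K` a single edge carries all but an
`ε`-fraction of the total weight. Such weights can be transported to larger graphs and put
together over vertex-disjoint graphs. -/
structure IsDominatedAllocation {V : Type*} [Fintype V] (K : SimpleGraph V) (α n ε : ℝ)
    (w : Sym2 V → ℝ) : Prop where
  one_le : ∀ e ∈ K.edgeSet, 1 ≤ n * w e
  eq_zero : ∀ e ∉ K.edgeSet, w e = 0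
  balance : ∀ x y, K.Adj x y →
    n * w s(x, y) = w s(x, y) ^ α / vertexWeight α w x + w s(x, y) ^ α / vertexWeight α w y
  dominant : ∀ x ∈ K.support, ∃ y, K.Adj x y ∧ (1 - ε) * vertexWeight α w x ≤ w s(x, y) ^ α

theorem extend_sym2Map_apply {V W : Type*} (f : W ↪ V) (w : Sym2 W → ℝ) (a b : W) :
    Function.extend (Sym2.map f) w 0 s(f a, f b) = w s(a, b) :=
  (Sym2.map.injective f.injective).extend_apply w 0 s(a, b)

theorem vertexWeight_extend {V W : Type*} [Fintype V] [Fintype W] (f : W ↪ V) {α : ℝ} (hα : α ≠ 0)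
    (w : Sym2 W → ℝ) (a : W) :
    vertexWeight α (Function.extend (Sym2.map f) w 0) (f a) = vertexWeight α w a := by
  refine (Fintype.sum_of_injective f f.injective _ _ (fun y hy => ?_) fun b => ?_).symm
  · rw [Function.extend_apply', Pi.zero_apply, Real.zero_rpow hα]
    rintro ⟨e, he⟩
    have hmem : y ∈ Sym2.map f e := he ▸ Sym2.mem_mk_right (f a) y
    obtain ⟨b, -, hb⟩ := Sym2.mem_map.mp hmem
    exact hy ⟨b, hb⟩
  · rw [extend_sym2Map_apply]

namespace IsDominatedAllocation

variable {V : Type*} [Fintype V] {K : SimpleGraph V} {α n ε : ℝ} {w : Sym2 V → ℝ}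

theorem pos (h : IsDominatedAllocation K α n ε w) (hn : 0 ≤ n) {e : Sym2 V} (he : e ∈ K.edgeSet) :
    0 < w e :=
  pos_of_mul_pos_right (one_pos.trans_le (h.one_le e he)) hn

theorem nonneg (h : IsDominatedAllocation K α n ε w) (hn : 0 ≤ n) (e : Sym2 V) : 0 ≤ w e := by
  by_cases he : e ∈ K.edgeSet
  · exact (h.pos hn he).le
  · exact (h.eq_zero e he).ge

theorem vertexWeight_pos (h : IsDominatedAllocation K α n ε w) (hn : 0 ≤ n) {x : V}
    (hx : x ∈ K.support) : 0 < vertexWeight α w x := by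
  obtain ⟨y, hy⟩ := hx
  exact Finset.sum_pos' (fun z _ => Real.rpow_nonneg (h.nonneg hn _) α)
    ⟨y, Finset.mem_univ y, Real.rpow_pos_of_pos (h.pos hn hy) α⟩

theorem isLinearlyStable {G : SimpleGraph V} [Nonempty V]
    (h : IsDominatedAllocation K α (Fintype.card V) ε w) (hKG : K ≤ G)
    (hK : K.support = Set.univ) (hα : 1 < α) (hε : 0 ≤ ε)
    (hsmall : 4 * α * ε * Fintype.card V < 1) :
    IsLinearlyStable (graphLaw G) α fun e => w e := by
  have hα0 : α ≠ 0 := by linarith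
  have hn : (0 : ℝ) ≤ Fintype.card V := Nat.cast_nonneg _
  have hzero : ∀ e ∉ G.edgeSet, w e = 0 := fun e he =>
    h.eq_zero e fun heK => he (SimpleGraph.edgeSet_mono hKG heK)
  have hpos : ∀ x, 0 < vertexWeight α w x := fun x => h.vertexWeight_pos hn (hK ▸ Set.mem_univ x)
  have heq : IsEquilibrium (graphLaw G) α fun e => w e := by
    refine (isEquilibrium_graphLaw_iff hα0 hzero).mpr
      ⟨fun e _ => h.nonneg hn e, fun x => (hpos x).ne', fun x y _ => ?_⟩
    by_cases hxy : K.Adj x y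
    · exact h.balance x y hxy
    · simp [h.eq_zero s(x, y) (by simpa using hxy), Real.zero_rpow hα0]
  rw [graphLaw_eq_incLaw] at heq ⊢
  refine isLinearlyStable_of_le_selProb hα hε hsmall heq (fun e he => ?_) fun x => ?_
  · exact h.one_le e (by_contra fun heK => he (h.eq_zero e heK))
  · obtain ⟨y, hxy, hdom⟩ := h.dominant x (hK ▸ Set.mem_univ x)
    refine ⟨⟨s(x, y), hKG hxy⟩, (h.pos hn hxy).ne', ?_⟩
    rwa [selProb_incidentEdges hα0 hzero, le_div_iff₀ (hpos x)]

section Map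

variable {W : Type*} [Fintype W] (f : W ↪ V) {w : Sym2 W → ℝ}

theorem map {K : SimpleGraph W} (h : IsDominatedAllocation K α n ε w) (hα : α ≠ 0) :
    IsDominatedAllocation (K.map f) α n ε (Function.extend (Sym2.map f) w 0) where
  one_le e he := by
    rw [SimpleGraph.edgeSet_map] at he
    obtain ⟨e, he, rfl⟩ := he
    have := h.one_le e he
    rwa [← (Sym2.map.injective f.injective).extend_apply w 0 e] at this
  eq_zero e he := by
    rw [SimpleGraph.edgeSet_map] at he
    by_cases hmem : ∃ e', Sym2.map f e' = e
    · obtain ⟨e', rfl⟩ := hmem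
      rw [(Sym2.map.injective f.injective).extend_apply]
      exact h.eq_zero e' fun he' => he ⟨e', he', rfl⟩
    · rw [Function.extend_apply' _ _ _ hmem, Pi.zero_apply]
  balance x y hxy := by
    obtain ⟨a, b, hab, rfl, rfl⟩ := (SimpleGraph.map_adj f K x y).mp hxy
    simpa only [extend_sym2Map_apply, vertexWeight_extend f hα] using h.balance a b hab
  dominant x hx := by
    obtain ⟨y, hxy⟩ := hx
    obtain ⟨a, b, hab, rfl, rfl⟩ := (SimpleGraph.map_adj f K x y).mp hxy
    obtain ⟨c, hac, hc⟩ := h.dominant a ⟨b, hab⟩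
    refine ⟨f c, (SimpleGraph.map_adj f K _ _).mpr ⟨a, c, hac, rfl, rfl⟩, ?_⟩
    rwa [extend_sym2Map_apply, vertexWeight_extend f hα]

end Map

section Union

variable {ι : Type*} [Fintype ι] {K : ι → SimpleGraph V} {w : ι → Sym2 V → ℝ}

theorem sum_apply_eq (h : ∀ j, IsDominatedAllocation (K j) α n ε (w j))
    (hdisj : Pairwise fun i j => Disjoint (K i).support (K j).support) {j : ι} {x : V}
    (hx : x ∈ (K j).support) (y : V) : ∑ i, w i s(x, y) = w j s(x, y) :=
  Fintype.sum_eq_single j fun i hij => (h i).eq_zero _ fun hadj =>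
    Set.disjoint_left.mp (hdisj hij) ⟨y, hadj⟩ hx

theorem iSup (h : ∀ j, IsDominatedAllocation (K j) α n ε (w j))
    (hdisj : Pairwise fun i j => Disjoint (K i).support (K j).support) :
    IsDominatedAllocation (⨆ j, K j) α n ε fun e => ∑ j, w j e := by
  have hweight : ∀ {j x}, x ∈ (K j).support →
      vertexWeight α (fun e => ∑ j, w j e) x = vertexWeight α (w j) x := fun hx => by
    simp only [vertexWeight, sum_apply_eq h hdisj hx]
  refine ⟨?_, fun e he => ?_, fun x y hxy => ?_, fun x ⟨y, hxy⟩ => ?_⟩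
  · rintro ⟨x, y⟩ hxy
    obtain ⟨j, hj⟩ := SimpleGraph.iSup_adj.mp hxy
    exact (sum_apply_eq h hdisj ⟨y, hj⟩ y).symm ▸ (h j).one_le _ hj
  · simp only [SimpleGraph.edgeSet_iSup, Set.mem_iUnion, not_exists] at he
    exact Finset.sum_eq_zero fun j _ => (h j).eq_zero e (he j)
  · obtain ⟨j, hj⟩ := SimpleGraph.iSup_adj.mp hxy
    rw [sum_apply_eq h hdisj ⟨y, hj⟩, hweight ⟨y, hj⟩, hweight ⟨x, hj.symm⟩]
    exact (h j).balance x y hj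
  · obtain ⟨j, hj⟩ := SimpleGraph.iSup_adj.mp hxy
    obtain ⟨z, hz, hdom⟩ := (h j).dominant x ⟨y, hj⟩
    refine ⟨z, SimpleGraph.iSup_adj.mpr ⟨j, hz⟩, ?_⟩
    rwa [sum_apply_eq h hdisj ⟨y, hj⟩, hweight ⟨y, hj⟩]

end Union

end IsDominatedAllocation

end Domination

/-! ### The threshold and the ratio equation -/

section Threshold

theorem thresholdFun_neg {α : ℝ} (h1 : 1 < α) (h2 : α ≤ 2) : thresholdFun α < 0 := by
  unfold thresholdFun
  have h3 : Real.log (2 * (α - 1)) ≤ Real.log α :=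
    Real.log_le_log (by linarith) (by linarith)
  have h4 : 0 < Real.log α := Real.log_pos h1
  nlinarith

theorem hasDerivAt_thresholdFun {α : ℝ} (h1 : 1 < α) :
    HasDerivAt thresholdFun (Real.log (2 * (α - 1)) - Real.log α) α := by
  have hα : α ≠ 0 := by linarith
  have hα1 : α - 1 ≠ 0 := by linarith
  have ha : HasDerivAt (fun x : ℝ => x - 1) 1 α := (hasDerivAt_id α).sub_const 1
  have hb : HasDerivAt (fun x : ℝ => Real.log (2 * (x - 1))) (2 * 1 / (2 * (α - 1))) α :=
    (ha.const_mul 2).log (by simpa using hα1)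
  have hc : HasDerivAt (fun x : ℝ => x * Real.log x) (1 * Real.log α + α * α⁻¹) α :=
    (hasDerivAt_id α).mul (Real.hasDerivAt_log hα)
  have := (ha.mul hb).sub hc
  refine this.congr_deriv ?_
  field_simp
  ring

theorem strictMonoOn_thresholdFun : StrictMonoOn thresholdFun (Set.Ici 2) := by
  refine strictMonoOn_of_deriv_pos (convex_Ici 2) (fun x hx => ?_) fun x hx => ?_
  · exact (hasDerivAt_thresholdFun
      (by linarith [Set.mem_Ici.mp hx])).continuousAt.continuousWithinAt
  · rw [interior_Ici, Set.mem_Ioi] at hx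
    rw [(hasDerivAt_thresholdFun (by linarith)).deriv, sub_pos]
    exact Real.log_lt_log (by linarith) (by linarith)

theorem tendsto_thresholdFun : Tendsto thresholdFun atTop atTop := by
  have h1 : Tendsto (fun α : ℝ => thresholdFun 4 + Real.log (3 / 2) * (α - 4)) atTop atTop := by
    refine tendsto_atTop_add_const_left _ _ ?_
    exact (tendsto_atTop_add_const_right _ _ tendsto_id).const_mul_atTop
      (Real.log_pos (by norm_num))
  refine tendsto_atTop_mono' _ ?_ h1
  filter_upwards [eventually_ge_atTop 4] with α hα
  have h2 : Real.log (3 / 2) * (α - 4) ≤ thresholdFun α - thresholdFun 4 := by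
    refine (convex_Ici (4 : ℝ)).mul_sub_le_image_sub_of_le_deriv
      (fun x hx => ?_) (fun x hx => ?_) (fun x hx => ?_) 4 (by simp) α hα hα
    · exact (hasDerivAt_thresholdFun
        (by linarith [Set.mem_Ici.mp hx])).continuousAt.continuousWithinAt
    · rw [interior_Ici, Set.mem_Ioi] at hx
      exact (hasDerivAt_thresholdFun (by linarith)).differentiableAt.differentiableWithinAt
    · rw [interior_Ici, Set.mem_Ioi] at hx
      rw [(hasDerivAt_thresholdFun (by linarith)).deriv,
        ← Real.log_div (by linarith) (by linarith)]
      refine Real.log_le_log (by norm_num) ?_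
      rw [le_div_iff₀ (by linarith)]
      linarith
  linarith

theorem exists_threshold {y : ℝ} (hy : 0 ≤ y) :
    ∃ a : ℝ, 1 < a ∧ thresholdFun a = y ∧ (∀ α, a < α → y < thresholdFun α) ∧
      ∀ α, 1 < α → α < a → thresholdFun α < y := by
  have h2 : thresholdFun 2 < 0 := thresholdFun_neg (by norm_num) le_rfl
  obtain ⟨b, hyb, h2b⟩ := ((tendsto_thresholdFun.eventually_ge_atTop y).and
    (eventually_ge_atTop 2)).exists
  have hcont : ContinuousOn thresholdFun (Set.Icc 2 b) := fun x hx =>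
    (hasDerivAt_thresholdFun (by linarith [hx.1])).continuousAt.continuousWithinAt
  obtain ⟨a, ⟨ha2, -⟩, rfl⟩ := intermediate_value_Icc h2b hcont ⟨h2.le.trans hy, hyb⟩
  refine ⟨a, by linarith, rfl, fun α hα => ?_, fun α h1 hα => ?_⟩
  · exact strictMonoOn_thresholdFun ha2 (ha2.trans hα.le) hα
  · rcases le_total α 2 with h | h
    · exact (thresholdFun_neg h1 h).trans_le hy
    · exact strictMonoOn_thresholdFun h ha2 hα

theorem rpow_eq_of_thresholdFun_eq {a c : ℝ} (ha : 1 < a) (hc : 0 < c)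
    (h : thresholdFun a = Real.log (c / 2)) :
    (2 * (1 - 1 / a)) ^ (a - 1) = a / 2 * c := by
  have ha0 : 0 < a := by linarith
  have h1 : 2 * (1 - 1 / a) = 2 * (a - 1) / a := by field_simp
  have h2 : 0 < 2 * (a - 1) / a := div_pos (by linarith) ha0
  rw [h1, Real.rpow_def_of_pos h2, Real.log_div (by linarith) ha0.ne']
  have h3 : (Real.log (2 * (a - 1)) - Real.log a) * (a - 1) =
      Real.log a + Real.log (c / 2) := by
    rw [← h, thresholdFun]
    ring
  rw [h3, Real.exp_add, Real.exp_log ha0, Real.exp_log (by linarith)]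
  ring

end Threshold

section RatioEquation

/-- The function whose positive zeros are, for `c = r + 1`, the quotients `v / u` of the equilibria
`((v)_r, u, (v)_r)` with `u > 0`. -/
def ratioFun (c α t : ℝ) : ℝ := c * t ^ α - 2 * t + 1

/-- The positive zeros of `ratioFun c α`. -/
def ratioRoots (c α : ℝ) : Set ℝ := {t | 0 < t ∧ ratioFun c α t = 0}

/-- The point at which `ratioFun c α` attains its minimum over the positive reals. -/
def ratioMin (c α : ℝ) : ℝ := (2 / (α * c)) ^ (1 / (α - 1))

variable {c α t : ℝ}

theorem ratioMin_pos (hc : 0 < c) (hα : 1 < α) : 0 < ratioMin c α := by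
  have : 0 < α := by linarith
  unfold ratioMin
  positivity

theorem ratioMin_rpow (hc : 0 < c) (hα : 1 < α) : α * c * ratioMin c α ^ (α - 1) = 2 := by
  have hα0 : 0 < α := by linarith
  have hα1 : α - 1 ≠ 0 := by linarith
  rw [ratioMin, ← Real.rpow_mul (by positivity), one_div_mul_cancel hα1, Real.rpow_one]
  field_simp [hα0.ne']

theorem continuous_ratioFun (hα : 1 < α) : Continuous (ratioFun c α) := by
  have : Continuous fun t : ℝ => t ^ α := Real.continuous_rpow_const (by linarith)
  unfold ratioFun
  fun_prop

theorem hasDerivAt_ratioFun (hα : 1 < α) (t : ℝ) :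
    HasDerivAt (ratioFun c α) (α * c * t ^ (α - 1) - 2) t := by
  have h1 := (Real.hasDerivAt_rpow_const (x := t) (Or.inr hα.le)).const_mul c
  have h2 : HasDerivAt (fun t : ℝ => 2 * t) 2 t := by
    simpa using (hasDerivAt_id t).const_mul (2 : ℝ)
  refine ((h1.sub h2).add_const 1).congr_deriv ?_
  ring

theorem lt_ratioMin_iff (hc : 0 < c) (hα : 1 < α) (ht : 0 ≤ t) :
    t < ratioMin c α ↔ α * c * t ^ (α - 1) < 2 := by
  have h0 : 0 < α * c := by nlinarith
  conv_rhs => rw [← ratioMin_rpow hc hα]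
  rw [mul_lt_mul_iff_right₀ h0,
    Real.rpow_lt_rpow_iff ht (ratioMin_pos hc hα).le (by linarith)]

theorem ratioMin_lt_iff (hc : 0 < c) (hα : 1 < α) (ht : 0 ≤ t) :
    ratioMin c α < t ↔ 2 < α * c * t ^ (α - 1) := by
  have h0 : 0 < α * c := by nlinarith
  conv_rhs => lhs; rw [← ratioMin_rpow hc hα]
  rw [mul_lt_mul_iff_right₀ h0,
    Real.rpow_lt_rpow_iff (ratioMin_pos hc hα).le ht (by linarith)]

theorem strictAntiOn_ratioFun (hc : 0 < c) (hα : 1 < α) :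
    StrictAntiOn (ratioFun c α) (Set.Icc 0 (ratioMin c α)) := by
  refine strictAntiOn_of_deriv_neg (convex_Icc _ _) (continuous_ratioFun hα).continuousOn
    fun x hx => ?_
  rw [interior_Icc] at hx
  rw [(hasDerivAt_ratioFun hα x).deriv, sub_neg]
  exact (lt_ratioMin_iff hc hα hx.1.le).mp hx.2

theorem strictMonoOn_ratioFun (hc : 0 < c) (hα : 1 < α) :
    StrictMonoOn (ratioFun c α) (Set.Ici (ratioMin c α)) := by
  refine strictMonoOn_of_deriv_pos (convex_Ici _) (continuous_ratioFun hα).continuousOn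
    fun x hx => ?_
  rw [interior_Ici] at hx
  rw [(hasDerivAt_ratioFun hα x).deriv, sub_pos]
  exact (ratioMin_lt_iff hc hα ((ratioMin_pos hc hα).trans hx).le).mp hx

theorem ratioFun_ratioMin (hc : 0 < c) (hα : 1 < α) :
    ratioFun c α (ratioMin c α) = 1 - 2 * (1 - 1 / α) * ratioMin c α := by
  have hcrit := ratioMin_rpow hc hα
  rw [Real.rpow_sub_one (ratioMin_pos hc hα).ne'] at hcrit
  have hpow : c * ratioMin c α ^ α = 2 * ratioMin c α / α := by
    have hα0 : α ≠ 0 := by linarith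
    have hmin := (ratioMin_pos hc hα).ne'
    field_simp at hcrit ⊢
    linarith
  rw [ratioFun, hpow]
  ring

theorem sub_one_mul_log_ratioMin (hc : 0 < c) (hα : 1 < α) :
    (α - 1) * Real.log (2 * (1 - 1 / α) * ratioMin c α) =
      thresholdFun α - Real.log (c / 2) := by
  have h0 : 0 < α := by linarith
  have h1 : α - 1 ≠ 0 := by linarith
  have h2 : 2 * (1 - 1 / α) = 2 * (α - 1) / α := by field_simp
  have h3 : 0 < 2 * (α - 1) := by linarith
  rw [h2, Real.log_mul (by positivity) (ratioMin_pos hc hα).ne', Real.log_div h3.ne' h0.ne',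
    ratioMin, Real.log_rpow (by positivity), Real.log_div two_ne_zero (by positivity),
    Real.log_mul h0.ne' hc.ne', Real.log_div hc.ne' two_ne_zero, thresholdFun]
  field_simp
  ring

theorem two_mul_one_sub_mul_ratioMin_pos (hc : 0 < c) (hα : 1 < α) :
    0 < 2 * (1 - 1 / α) * ratioMin c α := by
  have : 0 < 1 - 1 / α := sub_pos.mpr ((div_lt_one (by linarith)).mpr hα)
  exact mul_pos (mul_pos two_pos this) (ratioMin_pos hc hα)

theorem ratioFun_ratioMin_neg_iff (hc : 0 < c) (hα : 1 < α) :
    ratioFun c α (ratioMin c α) < 0 ↔ Real.log (c / 2) < thresholdFun α := by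
  rw [ratioFun_ratioMin hc hα, sub_neg,
    ← Real.log_pos_iff (two_mul_one_sub_mul_ratioMin_pos hc hα).le,
    ← mul_pos_iff_of_pos_left (sub_pos.mpr hα), sub_one_mul_log_ratioMin hc hα, sub_pos]

theorem ratioFun_ratioMin_pos_iff (hc : 0 < c) (hα : 1 < α) :
    0 < ratioFun c α (ratioMin c α) ↔ thresholdFun α < Real.log (c / 2) := by
  rw [ratioFun_ratioMin hc hα, sub_pos,
    ← Real.log_neg_iff (two_mul_one_sub_mul_ratioMin_pos hc hα),
    ← smul_neg_iff_of_pos_left (sub_pos.mpr hα), smul_eq_mul,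
    sub_one_mul_log_ratioMin hc hα, sub_neg]

theorem ratioFun_ratioMin_le (hc : 0 < c) (hα : 1 < α) (ht : 0 ≤ t) :
    ratioFun c α (ratioMin c α) ≤ ratioFun c α t := by
  rcases le_total t (ratioMin c α) with h | h
  · exact (strictAntiOn_ratioFun hc hα).antitoneOn ⟨ht, h⟩ ⟨(ratioMin_pos hc hα).le, le_rfl⟩ h
  · exact (strictMonoOn_ratioFun hc hα).monotoneOn Set.self_mem_Ici h h

theorem ratioRoots_eq_empty (hc : 0 < c) (hα : 1 < α) (h : thresholdFun α < Real.log (c / 2)) :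
    ratioRoots c α = ∅ :=
  Set.eq_empty_of_forall_notMem fun _ ht => ht.2.not_gt <|
    ((ratioFun_ratioMin_pos_iff hc hα).mpr h).trans_le (ratioFun_ratioMin_le hc hα ht.1.le)

theorem half_lt_of_mem_ratioRoots (hc : 0 < c) (ht : t ∈ ratioRoots c α) : 1 / 2 < t := by
  have hpos : 0 < c * t ^ α := mul_pos hc (Real.rpow_pos_of_pos ht.1 α)
  have hroot : c * t ^ α - 2 * t + 1 = 0 := ht.2
  linarith

theorem lt_one_of_mem_ratioRoots (hc : 2 ≤ c) (hα : 1 < α) (ht : t ∈ ratioRoots c α) : t < 1 := by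
  by_contra! h1
  have hle : t ≤ t ^ α := Real.self_le_rpow_of_one_le h1 hα.le
  have hroot : c * t ^ α - 2 * t + 1 = 0 := ht.2
  nlinarith

theorem exists_ratioRoots_eq_pair (hc : 2 ≤ c) (hα : 1 < α)
    (h : Real.log (c / 2) < thresholdFun α) :
    ∃ t₁ t₂, ratioRoots c α = {t₁, t₂} ∧ t₁ < ratioMin c α ∧ ratioMin c α < t₂ := by
  have hc0 : 0 < c := by linarith
  have hp := ratioMin_pos hc0 hα
  have hneg := (ratioFun_ratioMin_neg_iff hc0 hα).mpr h
  have hcont : Continuous (ratioFun c α) := continuous_ratioFun hα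
  have hzero : ratioFun c α 0 = 1 := by simp [ratioFun, Real.zero_rpow (by linarith : α ≠ 0)]
  have hbig : 0 < ratioFun c α (ratioMin c α + 1) := by
    have : ratioMin c α + 1 ≤ (ratioMin c α + 1) ^ α :=
      Real.self_le_rpow_of_one_le (by linarith) hα.le
    unfold ratioFun
    nlinarith
  obtain ⟨t₁, ⟨ht₁0, ht₁⟩, h₁⟩ := intermediate_value_Ioo' hp.le hcont.continuousOn
    (show (0 : ℝ) ∈ Set.Ioo _ _ from ⟨hneg, hzero ▸ one_pos⟩)
  obtain ⟨t₂, ⟨ht₂, -⟩, h₂⟩ := intermediate_value_Ioo (le_add_of_nonneg_right zero_le_one)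
    hcont.continuousOn (show (0 : ℝ) ∈ Set.Ioo _ _ from ⟨hneg, hbig⟩)
  refine ⟨t₁, t₂, Set.Subset.antisymm (fun t ⟨ht, h0⟩ => ?_)
    (Set.pair_subset ⟨ht₁0, h₁⟩ ⟨hp.trans ht₂, h₂⟩), ht₁, ht₂⟩
  rcases le_total t (ratioMin c α) with hle | hle
  · exact Or.inl ((strictAntiOn_ratioFun hc0 hα).injOn ⟨ht.le, hle⟩ ⟨ht₁0.le, ht₁.le⟩
      (h0.trans h₁.symm))
  · exact Or.inr ((strictMonoOn_ratioFun hc0 hα).injOn hle ht₂.le (h0.trans h₂.symm))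

theorem lt_of_mem_ratioRoots {β s : ℝ} (hc : 2 ≤ c) (hα : 1 < α) (hαβ : α < β)
    (ht : t ∈ ratioRoots c α) (hs : s ∈ ratioRoots c β) (hmin : s < ratioMin c β) : s < t := by
  by_contra! hle
  have hc0 : 0 < c := by linarith
  have hpow : t ^ β < t ^ α :=
    Real.rpow_lt_rpow_of_exponent_gt ht.1 (lt_one_of_mem_ratioRoots hc hα ht) hαβ
  have hneg : ratioFun c β t < 0 := by
    rw [← ht.2]
    unfold ratioFun
    nlinarith
  have hanti := (strictAntiOn_ratioFun hc0 (hα.trans hαβ)).antitoneOn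
    ⟨ht.1.le, hle.trans hmin.le⟩ ⟨hs.1.le, hmin.le⟩ hle
  linarith [hs.2]

theorem tendsto_of_mem_ratioRoots {a : ℝ} {τ : ℝ → ℝ} (hc : 2 ≤ c) (ha : 1 < a)
    (hτ : ∀ α, a < α → τ α ∈ ratioRoots c α) (hanti : StrictAntiOn τ (Set.Ioi a)) :
    Tendsto τ atTop (𝓝 (1 / 2)) := by
  have hb : a < a + 1 := lt_add_one a
  have hlim : Tendsto (fun α : ℝ => 1 / 2 + c / 2 * τ (a + 1) ^ α) atTop (𝓝 (1 / 2)) := by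
    have := tendsto_rpow_atTop_of_base_lt_one (τ (a + 1)) (by linarith [(hτ _ hb).1])
      (lt_one_of_mem_ratioRoots hc (by linarith) (hτ _ hb))
    simpa only [mul_zero, add_zero] using (this.const_mul (c / 2)).const_add (1 / 2)
  refine tendsto_of_tendsto_of_tendsto_of_le_of_le' tendsto_const_nhds hlim ?_ ?_
  · filter_upwards [eventually_gt_atTop a] with α hα
    exact (half_lt_of_mem_ratioRoots (by linarith) (hτ α hα)).le
  · filter_upwards [eventually_gt_atTop (a + 1)] with α hα
    obtain ⟨hpos, hroot⟩ := hτ α (hb.trans hα)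
    have hpow : τ α ^ α ≤ τ (a + 1) ^ α :=
      Real.rpow_le_rpow hpos.le (hanti hb (hb.trans hα) hα).le (by linarith)
    unfold ratioFun at hroot
    nlinarith

theorem exists_ratioRoots_branches {a : ℝ} (hc : 2 ≤ c) (ha : 1 < a)
    (h : ∀ α, a < α → Real.log (c / 2) < thresholdFun α) :
    ∃ t₁ t₂ : ℝ → ℝ, (∀ α, a < α →
        ratioRoots c α = {t₁ α, t₂ α} ∧ t₁ α < ratioMin c α ∧ ratioMin c α < t₂ α) ∧
      StrictAntiOn t₁ (Set.Ioi a) ∧ Tendsto t₁ atTop (𝓝 (1 / 2)) := by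
  choose! t₁ t₂ ht using fun α (hα : a < α) =>
    exists_ratioRoots_eq_pair hc (ha.trans hα) (h α hα)
  have hmem : ∀ α, a < α → t₁ α ∈ ratioRoots c α := fun α hα => by
    rw [(ht α hα).1]
    exact Set.mem_insert _ _
  have hanti : StrictAntiOn t₁ (Set.Ioi a) := fun α hα β hβ hαβ =>
    lt_of_mem_ratioRoots hc (ha.trans hα) hαβ (hmem α hα) (hmem β hβ) (ht β hβ).2.1
  exact ⟨t₁, t₂, ht, hanti, tendsto_of_mem_ratioRoots hc ha hmem hanti⟩

end RatioEquation

/-! ### Symmetric equilibria on whisker graphs -/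

section WhiskerWeights

variable {r s : ℕ} {α v u n : ℝ}

theorem forall_whiskerGraph_adj_iff
    {P : Bool ⊕ (Fin r ⊕ Fin s) → Bool ⊕ (Fin r ⊕ Fin s) → Prop} (hP : ∀ x y, P x y → P y x) :
    (∀ x y, (whiskerGraph r s).Adj x y → P x y) ↔ P (Sum.inl false) (Sum.inl true) ∧
      (∀ i, P (Sum.inl false) (Sum.inr (Sum.inl i))) ∧
        ∀ i, P (Sum.inl true) (Sum.inr (Sum.inr i)) := by
  refine ⟨fun h => ⟨h _ _ (by simp [whiskerGraph]), fun i => h _ _ (by simp [whiskerGraph]),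
    fun i => h _ _ (by simp [whiskerGraph])⟩, fun ⟨hc, hl, hr⟩ => ?_⟩
  rintro ((_ | _) | i | i) ((_ | _) | j | j) h
  all_goals first
    | exact hc
    | exact hl _
    | exact hr _
    | exact hP _ _ hc
    | exact hP _ _ (hl _)
    | exact hP _ _ (hr _)
    | simp [whiskerGraph] at h

/-- The edge joining the two centres. -/
def centreEdge (r s : ℕ) : (whiskerGraph r s).edgeSet :=
  ⟨s(Sum.inl false, Sum.inl true), by simp [whiskerGraph]⟩

/-- The edge to the `i`-th leaf at the first centre. -/
def leftEdge (i : Fin r) : (whiskerGraph r s).edgeSet :=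
  ⟨s(Sum.inl false, Sum.inr (Sum.inl i)), by simp [whiskerGraph]⟩

/-- The edge to the `i`-th leaf at the second centre. -/
def rightEdge (i : Fin s) : (whiskerGraph r s).edgeSet :=
  ⟨s(Sum.inl true, Sum.inr (Sum.inr i)), by simp [whiskerGraph]⟩

theorem forall_whiskerGraph_edge_iff {P : (whiskerGraph r s).edgeSet → Prop} :
    (∀ e, P e) ↔ P (centreEdge r s) ∧ (∀ i, P (leftEdge i)) ∧ ∀ i, P (rightEdge i) := by
  refine ⟨fun h => ⟨h _, fun i => h _, fun i => h _⟩, fun ⟨hc, hl, hr⟩ => ?_⟩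
  have hadj := (forall_whiskerGraph_adj_iff
    (P := fun x y => ∀ h : s(x, y) ∈ (whiskerGraph r s).edgeSet, P ⟨s(x, y), h⟩)
    fun x y h => by simpa only [Sym2.eq_swap] using h).mpr
      ⟨fun _ => hc, fun i _ => hl i, fun i _ => hr i⟩
  rintro ⟨⟨x, y⟩, h⟩
  exact hadj x y h h

theorem sum_whiskerGraph_edge (φ : (whiskerGraph r s).edgeSet → ℝ) :
    ∑ e, φ e = φ (centreEdge r s) + (∑ i, φ (leftEdge i) + ∑ i, φ (rightEdge i)) := by
  let edge : Option (Fin r ⊕ Fin s) → (whiskerGraph r s).edgeSet :=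
    fun o => o.elim (centreEdge r s) (Sum.elim leftEdge rightEdge)
  have hedge : Function.Bijective edge := by
    refine ⟨?_, forall_whiskerGraph_edge_iff.mpr ⟨⟨none, rfl⟩, fun i => ⟨some (Sum.inl i), rfl⟩,
      fun i => ⟨some (Sum.inr i), rfl⟩⟩⟩
    rintro (_ | i | i) (_ | j | j) h <;>
      simp_all [edge, centreEdge, leftEdge, rightEdge, Subtype.ext_iff]
  rw [← hedge.sum_comp, Fintype.sum_option, Fintype.sum_sum_type]
  simp [edge]

/-- The edge weights of `((v)_r, u, (v)_s)` on the `(r, s)`-whisker graph, extended by `0` to all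
unordered pairs of vertices. -/
def whiskerWeight (r s : ℕ) (v u : ℝ) (e : Sym2 (Bool ⊕ (Fin r ⊕ Fin s))) : ℝ :=
  if e = s(Sum.inl false, Sum.inl true) then u else if e ∈ (whiskerGraph r s).edgeSet then v else 0

theorem whiskerWeight_eq_zero : ∀ e ∉ (whiskerGraph r s).edgeSet, whiskerWeight r s v u e = 0 := by
  intro e he
  have hne : e ≠ s(Sum.inl false, Sum.inl true) := fun h => he (h ▸ (centreEdge r s).2)
  rw [whiskerWeight, if_neg hne, if_neg he]

theorem whiskerVector_eq_whiskerWeight :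
    whiskerVector r v u = fun e : (whiskerGraph r r).edgeSet => whiskerWeight r r v u e := by
  ext e
  simp [whiskerVector, whiskerWeight]

@[simp]
theorem whiskerWeight_centre : whiskerWeight r s v u s(Sum.inl false, Sum.inl true) = u := by
  simp [whiskerWeight]

@[simp]
theorem whiskerWeight_left (i : Fin r) :
    whiskerWeight r s v u s(Sum.inl false, Sum.inr (Sum.inl i)) = v := by
  simp [whiskerWeight, whiskerGraph]

@[simp]
theorem whiskerWeight_right (i : Fin s) :
    whiskerWeight r s v u s(Sum.inl true, Sum.inr (Sum.inr i)) = v := by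
  simp [whiskerWeight, whiskerGraph]

theorem vertexWeight_whiskerWeight_false (hα : α ≠ 0) :
    vertexWeight α (whiskerWeight r s v u) (Sum.inl false) = u ^ α + r * v ^ α := by
  simp [vertexWeight, Fintype.sum_sum_type, whiskerWeight, whiskerGraph, Real.zero_rpow hα]

theorem vertexWeight_whiskerWeight_true (hα : α ≠ 0) :
    vertexWeight α (whiskerWeight r s v u) (Sum.inl true) = u ^ α + s * v ^ α := by
  simp [vertexWeight, Fintype.sum_sum_type, whiskerWeight, whiskerGraph, Real.zero_rpow hα,
    Sym2.eq_swap]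

theorem vertexWeight_whiskerWeight_left (hα : α ≠ 0) (i : Fin r) :
    vertexWeight α (whiskerWeight r s v u) (Sum.inr (Sum.inl i)) = v ^ α := by
  simp [vertexWeight, Fintype.sum_sum_type, whiskerWeight, whiskerGraph, Real.zero_rpow hα]

theorem vertexWeight_whiskerWeight_right (hα : α ≠ 0) (i : Fin s) :
    vertexWeight α (whiskerWeight r s v u) (Sum.inr (Sum.inr i)) = v ^ α := by
  simp [vertexWeight, Fintype.sum_sum_type, whiskerWeight, whiskerGraph, Real.zero_rpow hα]

/-- The share of a single leaf edge in the total weight of a centre with `r` leaves, for the edge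
weights `v` at the leaves and `u` between the centres. -/
def leafProb (r : ℕ) (α v u : ℝ) : ℝ := v ^ α / (u ^ α + r * v ^ α)

theorem leafProb_nonneg (hv : 0 ≤ v) (hu : 0 ≤ u) : 0 ≤ leafProb r α v u := by
  unfold leafProb
  positivity

theorem rpow_div_eq_one_sub_leafProb (hv : 0 ≤ v) (hu : 0 < u) :
    u ^ α / (u ^ α + r * v ^ α) = 1 - r * leafProb r α v u := by
  have : 0 < u ^ α + r * v ^ α := by positivity
  rw [leafProb]
  field_simp
  ring

theorem whiskerWeight_balance_iff (hα : α ≠ 0) (hv : 0 < v) (hu : 0 < u) :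
    (∀ x y, (whiskerGraph r s).Adj x y → n * whiskerWeight r s v u s(x, y) =
      whiskerWeight r s v u s(x, y) ^ α / vertexWeight α (whiskerWeight r s v u) x +
        whiskerWeight r s v u s(x, y) ^ α / vertexWeight α (whiskerWeight r s v u) y) ↔
      n * u = (1 - r * leafProb r α v u) + (1 - s * leafProb s α v u) ∧
        (∀ _ : Fin r, n * v = leafProb r α v u + 1) ∧
          ∀ _ : Fin s, n * v = leafProb s α v u + 1 := by
  rw [forall_whiskerGraph_adj_iff fun x y h => by rwa [Sym2.eq_swap, add_comm]]
  simp only [whiskerWeight_centre, whiskerWeight_left, whiskerWeight_right,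
    vertexWeight_whiskerWeight_false hα, vertexWeight_whiskerWeight_true hα,
    vertexWeight_whiskerWeight_left hα, vertexWeight_whiskerWeight_right hα,
    rpow_div_eq_one_sub_leafProb hv.le hu, div_self (Real.rpow_pos_of_pos hv α).ne', leafProb]

theorem vertexWeight_whiskerWeight_pos (hα : α ≠ 0) (hv : 0 < v) (hu : 0 < u)
    (x : Bool ⊕ (Fin r ⊕ Fin s)) : 0 < vertexWeight α (whiskerWeight r s v u) x := by
  rcases x with (_ | _) | i | i
  · rw [vertexWeight_whiskerWeight_false hα]
    positivity
  · rw [vertexWeight_whiskerWeight_true hα]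
    positivity
  · rw [vertexWeight_whiskerWeight_left hα]
    positivity
  · rw [vertexWeight_whiskerWeight_right hα]
    positivity

theorem card_whiskerGraph : (Fintype.card (Bool ⊕ (Fin r ⊕ Fin r)) : ℝ) = 2 * (r + 1) := by
  simp
  ring

theorem isEquilibrium_whiskerVector_iff (hr : 1 ≤ r) (hα : α ≠ 0) (hu : 0 < u) :
    IsEquilibrium (graphLaw (whiskerGraph r r)) α (whiskerVector r v u) ↔
      0 < v ∧ (r + 1) * u = 1 - r * leafProb r α v u ∧
        2 * (r + 1) * v = 1 + leafProb r α v u := by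
  have hbal (hv : 0 < v) := whiskerWeight_balance_iff (r := r) (s := r) (n := 2 * (r + 1)) hα hv hu
  rw [whiskerVector_eq_whiskerWeight,
    isEquilibrium_graphLaw_iff hα whiskerWeight_eq_zero, card_whiskerGraph]
  constructor
  · rintro ⟨hnonneg, hne, h⟩
    have hv : 0 < v := by
      have hleaf := hnonneg _ (leftEdge (s := r) ⟨0, hr⟩).2
      rw [leftEdge, whiskerWeight_left] at hleaf
      refine hleaf.lt_of_ne' fun hv0 => ?_
      exact hne (Sum.inr (Sum.inl ⟨0, hr⟩))
        (by rw [vertexWeight_whiskerWeight_left hα, hv0, Real.zero_rpow hα])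
    obtain ⟨hcentre, hleft, -⟩ := (hbal hv).mp h
    exact ⟨hv, by linarith, by linarith [hleft ⟨0, hr⟩]⟩
  · rintro ⟨hv, hcentre, hleaf⟩
    refine ⟨fun e he => ?_, fun x => (vertexWeight_whiskerWeight_pos hα hv hu x).ne',
      (hbal hv).mpr ⟨by linarith, fun _ => by linarith, fun _ => by linarith⟩⟩
    rw [whiskerWeight]
    split_ifs
    exacts [hu.le, hv.le]

/-- The pair `(v, u)` with `v / u = t` for which the edge values of `((v)_r, u, (v)_r)` add up
to `1`. -/
def whiskerPair (r : ℕ) (t : ℝ) : ℝ × ℝ := (t / (1 + 2 * r * t), 1 / (1 + 2 * r * t))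

theorem leafProb_mul {t : ℝ} (ht : 0 ≤ t) (hu : 0 < u) :
    leafProb r α (t * u) u = t ^ α / (1 + r * t ^ α) := by
  have := Real.rpow_pos_of_pos hu α
  have : 0 < 1 + r * t ^ α := by positivity
  rw [leafProb, Real.mul_rpow ht hu.le]
  field_simp

theorem isEquilibrium_whiskerVector_mul_iff {t : ℝ} (hr : 1 ≤ r) (hα : α ≠ 0) (hu : 0 < u) :
    IsEquilibrium (graphLaw (whiskerGraph r r)) α (whiskerVector r (t * u) u) ↔
      t ∈ ratioRoots (r + 1) α ∧ (1 + 2 * r * t) * u = 1 := by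
  rw [isEquilibrium_whiskerVector_iff hr hα hu, mul_pos_iff_of_pos_right hu, ratioRoots,
    Set.mem_ofPred_eq, and_assoc]
  refine and_congr_right fun ht => ?_
  have hden : 0 < 1 + r * t ^ α := by positivity
  have hcentre : (1 + r * t ^ α) * (1 - r * leafProb r α (t * u) u) = 1 := by
    rw [leafProb_mul ht.le hu]
    field_simp
    ring
  have hside : (1 + r * t ^ α) * (1 + leafProb r α (t * u) u) = 1 + (r + 1) * t ^ α := by
    rw [leafProb_mul ht.le hu]
    field_simp
    ring
  rw [← mul_right_inj' hden.ne', hcentre, ← mul_right_inj' (b := 2 * (r + 1) * (t * u)) hden.ne',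
    hside, ratioFun]
  constructor
  · rintro ⟨hu, htu⟩
    have hroot : (r + 1) * t ^ α - 2 * t + 1 = 0 := by linear_combination 2 * t * hu - htu
    exact ⟨hroot, by linear_combination hu - r * u * hroot⟩
  · rintro ⟨hroot, hsum⟩
    have hu : (1 + r * t ^ α) * ((r + 1) * u) = 1 := by linear_combination hsum + r * u * hroot
    exact ⟨hu, by linear_combination 2 * t * hu - hroot⟩

theorem setOf_whiskerVector_mem_equilibria (hr : 1 ≤ r) (hα : α ≠ 0) :
    {q : ℝ × ℝ | 0 < q.2 ∧ whiskerVector r q.1 q.2 ∈ equilibria (whiskerGraph r r) α} =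
      whiskerPair r '' ratioRoots (r + 1) α := by
  ext ⟨v, u⟩
  constructor
  · rintro ⟨hu, h : IsEquilibrium _ _ (whiskerVector r v u)⟩
    rw [← div_mul_cancel₀ v hu.ne', isEquilibrium_whiskerVector_mul_iff hr hα hu] at h
    refine ⟨v / u, h.1, ?_⟩
    rw [whiskerPair, ← eq_one_div_of_mul_eq_one_right h.2, div_eq_mul_one_div,
      ← eq_one_div_of_mul_eq_one_right h.2, div_mul_cancel₀ v hu.ne']
  · rintro ⟨t, ht, heq⟩
    have ht0 : 0 < t := ht.1
    have hu : 0 < 1 / (1 + 2 * r * t) := by positivity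
    obtain ⟨rfl, rfl⟩ := Prod.mk.inj heq
    refine ⟨hu, ?_⟩
    change IsEquilibrium _ _ (whiskerVector r _ _)
    rw [div_eq_mul_one_div t, isEquilibrium_whiskerVector_mul_iff hr hα hu]
    exact ⟨ht, mul_one_div_cancel (by positivity)⟩

end WhiskerWeights

/-! ### Stability of symmetric equilibria -/

section WhiskerStability

variable {r : ℕ} {α v u : ℝ}

theorem weightSum_whiskerVector (hα : α ≠ 0) (x : Bool ⊕ (Fin r ⊕ Fin r)) :
    weightSum (incidentEdges (whiskerGraph r r)) α (whiskerVector r v u) x =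
      vertexWeight α (whiskerWeight r r v u) x := by
  rw [whiskerVector_eq_whiskerWeight, weightSum_incidentEdges hα whiskerWeight_eq_zero]

@[simp]
theorem whiskerVector_centreEdge : whiskerVector r v u (centreEdge r r) = u := by
  simp [whiskerVector, centreEdge]

@[simp]
theorem whiskerVector_leftEdge (i : Fin r) : whiskerVector r v u (leftEdge i) = v := by
  simp [whiskerVector, leftEdge]

@[simp]
theorem whiskerVector_rightEdge (i : Fin r) : whiskerVector r v u (rightEdge i) = v := by
  simp [whiskerVector, rightEdge]

theorem selMean_whiskerVector_false (hα : α ≠ 0) (hv : 0 ≤ v) (hu : 0 < u)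
    (y : (whiskerGraph r r).edgeSet → ℝ) :
    selMean (incidentEdges (whiskerGraph r r)) α (whiskerVector r v u) (Sum.inl false) y =
      (1 - r * leafProb r α v u) * y (centreEdge r r) +
        leafProb r α v u * ∑ i, y (leftEdge i) := by
  rw [selMean, sum_whiskerGraph_edge, ← rpow_div_eq_one_sub_leafProb hv hu, Finset.mul_sum]
  simp [selProb, mem_incidentEdges, weightSum_whiskerVector hα,
    vertexWeight_whiskerWeight_false hα, leafProb, centreEdge, leftEdge, rightEdge, whiskerVector]

theorem selMean_whiskerVector_true (hα : α ≠ 0) (hv : 0 ≤ v) (hu : 0 < u)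
    (y : (whiskerGraph r r).edgeSet → ℝ) :
    selMean (incidentEdges (whiskerGraph r r)) α (whiskerVector r v u) (Sum.inl true) y =
      (1 - r * leafProb r α v u) * y (centreEdge r r) +
        leafProb r α v u * ∑ i, y (rightEdge i) := by
  rw [selMean, sum_whiskerGraph_edge, ← rpow_div_eq_one_sub_leafProb hv hu, Finset.mul_sum]
  simp [selProb, mem_incidentEdges, weightSum_whiskerVector hα,
    vertexWeight_whiskerWeight_true hα, leafProb, centreEdge, leftEdge, rightEdge, whiskerVector]

theorem selMean_whiskerVector_left (hα : α ≠ 0) (hv : 0 < v)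
    (y : (whiskerGraph r r).edgeSet → ℝ) (i : Fin r) :
    selMean (incidentEdges (whiskerGraph r r)) α (whiskerVector r v u) (Sum.inr (Sum.inl i)) y =
      y (leftEdge i) := by
  rw [selMean, sum_whiskerGraph_edge]
  simp [selProb, mem_incidentEdges, weightSum_whiskerVector hα,
    vertexWeight_whiskerWeight_left hα, centreEdge, leftEdge, rightEdge, whiskerVector,
    (Real.rpow_pos_of_pos hv α).ne']

theorem selMean_whiskerVector_right (hα : α ≠ 0) (hv : 0 < v)
    (y : (whiskerGraph r r).edgeSet → ℝ) (i : Fin r) :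
    selMean (incidentEdges (whiskerGraph r r)) α (whiskerVector r v u) (Sum.inr (Sum.inr i)) y =
      y (rightEdge i) := by
  rw [selMean, sum_whiskerGraph_edge]
  simp [selProb, mem_incidentEdges, weightSum_whiskerVector hα,
    vertexWeight_whiskerWeight_right hα, centreEdge, leftEdge, rightEdge, whiskerVector,
    (Real.rpow_pos_of_pos hv α).ne']

/-- The variance of the values `c` with probability `1 - r * p` and `a 0, …, a (r - 1)` with
probability `p` each; this is what one centre contributes to the stability of a symmetric
equilibrium. -/
def centreVar (p c : ℝ) (a : Fin r → ℝ) : ℝ :=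
  (1 - r * p) * c ^ 2 + p * ∑ i, a i ^ 2 - ((1 - r * p) * c + p * ∑ i, a i) ^ 2

theorem sum_selVar_whiskerVector (hα : α ≠ 0) (hv : 0 < v) (hu : 0 < u)
    (y : (whiskerGraph r r).edgeSet → ℝ) :
    ∑ x, selVar (incidentEdges (whiskerGraph r r)) α (whiskerVector r v u) x y =
      centreVar (leafProb r α v u) (y (centreEdge r r)) (fun i => y (leftEdge i)) +
        centreVar (leafProb r α v u) (y (centreEdge r r)) (fun i => y (rightEdge i)) := by
  simp only [selVar, Fintype.sum_sum_type, Fintype.sum_bool, selMean_whiskerVector_left hα hv,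
    selMean_whiskerVector_right hα hv, selMean_whiskerVector_false hα hv.le hu,
    selMean_whiskerVector_true hα hv.le hu, sub_self, Finset.sum_const_zero, add_zero, centreVar]
  ring

-- Cauchy-Schwarz reduces to constant `a`; then the difference of the two sides is a square, which
-- vanishes for `(1 - r * p) * c + r * (1 + p) * a = 0`.
theorem centreVar_le {p θ : ℝ} (hα : 0 ≤ α) (hp : 0 ≤ p) (hθ0 : 0 ≤ θ)
    (hθ : θ * (1 + p) = α * p * (r + 1)) (c : ℝ) (a : Fin r → ℝ) :
    α * centreVar p c a ≤ θ * ((1 - r * p) * c ^ 2 + (1 + p) * ∑ i, a i ^ 2) := by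
  obtain ⟨m, hm⟩ : ∃ m, ∑ i, a i = r * m := by
    rcases eq_or_ne r 0 with rfl | hr
    · exact ⟨0, by simp⟩
    · exact ⟨_, (mul_div_cancel₀ (∑ i, a i) (Nat.cast_ne_zero.mpr hr)).symm⟩
  have hcs : (∑ i, a i) ^ 2 ≤ r * ∑ i, a i ^ 2 := by
    simpa using sq_sum_le_card_mul_sum_sq (s := Finset.univ) (f := a)
  unfold centreVar
  rw [hm] at hcs ⊢
  set Q := ∑ i, a i ^ 2
  have hQ : 0 ≤ r * (Q - r * m ^ 2) := by linarith
  have hsum : 0 ≤ θ * (r * (1 + p) * m + (1 - r * p) * c) ^ 2 +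
    (r + 1) * (α * p * (r * (Q - r * m ^ 2))) := by positivity
  rw [← sub_nonneg]
  refine nonneg_of_mul_nonneg_right (a := (r : ℝ) + 1) (hsum.trans_eq ?_) (by positivity)
  linear_combination (-(r * (1 - r * p) * (m - c) ^ 2) - (r + 1) * (Q - r * m ^ 2)) * hθ

theorem isLinearlyStable_whiskerVector (hr : 1 ≤ r) (hα : 1 < α) (hu : 0 < u)
    (heq : IsEquilibrium (graphLaw (whiskerGraph r r)) α (whiskerVector r v u))
    (h : α * (r + 1) * leafProb r α v u < 1 + leafProb r α v u) :
    IsLinearlyStable (graphLaw (whiskerGraph r r)) α (whiskerVector r v u) := by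
  obtain ⟨hv, hcentre, hleaf⟩ := (isEquilibrium_whiskerVector_iff hr (by linarith) hu).mp heq
  have hp := leafProb_nonneg (r := r) (α := α) hv.le hu.le
  have hvar := sum_selVar_whiskerVector (r := r) (by linarith : α ≠ 0) hv hu
  set p := leafProb r α v u
  rw [graphLaw_eq_incLaw] at heq ⊢
  refine isLinearlyStable_of_selVar_le (θ := α * (r + 1) * p / (1 + p)) hα (by positivity)
    ((div_lt_one (by linarith)).mpr h) heq fun y => ?_
  have hle := centreVar_le (r := r) (θ := α * (r + 1) * p / (1 + p)) (α := α) (by linarith) hp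
    (by positivity) (by field_simp) (y (centreEdge r r))
  calc α * ∑ x, selVar (incidentEdges (whiskerGraph r r)) α (whiskerVector r v u) x y
      ≤ α * (r + 1) * p / (1 + p) *
          (((1 - r * p) * y (centreEdge r r) ^ 2 + (1 + p) * ∑ i, y (leftEdge i) ^ 2) +
          ((1 - r * p) * y (centreEdge r r) ^ 2 + (1 + p) * ∑ i, y (rightEdge i) ^ 2)) := by
        rw [hvar, mul_add, mul_add]
        exact add_le_add (hle _) (hle _)
    _ = _ := by
        rw [sum_whiskerGraph_edge, card_whiskerGraph]
        simp only [whiskerVector_centreEdge, whiskerVector_leftEdge, whiskerVector_rightEdge,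
          ← Finset.mul_sum, ← hcentre, ← hleaf]
        ring

/-- An eigenvector of the gain matrix at a symmetric equilibrium, relative to the weights of the
equilibrium: the equality case of `centreVar_le`. -/
def whiskerMode (r : ℕ) (p : ℝ) : (whiskerGraph r r).edgeSet → ℝ :=
  whiskerVector r 1 (-(r * (1 + p)) / (1 - r * p))

theorem sum_selProb_centreEdge_mul (hα : α ≠ 0) (hv : 0 ≤ v) (hu : 0 < u)
    (F : Bool ⊕ (Fin r ⊕ Fin r) → ℝ) :
    ∑ x, selProb (incidentEdges (whiskerGraph r r)) α (whiskerVector r v u) x (centreEdge r r) *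
      F x = (1 - r * leafProb r α v u) * (F (Sum.inl false) + F (Sum.inl true)) := by
  rw [← rpow_div_eq_one_sub_leafProb hv hu]
  simp [selProb, mem_incidentEdges, weightSum_whiskerVector hα, Fintype.sum_sum_type,
    vertexWeight_whiskerWeight_false hα, vertexWeight_whiskerWeight_true hα, centreEdge,
    whiskerVector, mul_add, add_comm]

theorem sum_selProb_leftEdge_mul (hα : α ≠ 0) (hv : 0 < v) (i : Fin r)
    (F : Bool ⊕ (Fin r ⊕ Fin r) → ℝ) :
    ∑ x, selProb (incidentEdges (whiskerGraph r r)) α (whiskerVector r v u) x (leftEdge i) *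
      F x = leafProb r α v u * F (Sum.inl false) + F (Sum.inr (Sum.inl i)) := by
  simp [selProb, mem_incidentEdges, weightSum_whiskerVector hα, Fintype.sum_sum_type,
    vertexWeight_whiskerWeight_false hα, vertexWeight_whiskerWeight_left hα, leftEdge,
    whiskerVector, leafProb, (Real.rpow_pos_of_pos hv α).ne']

theorem sum_selProb_rightEdge_mul (hα : α ≠ 0) (hv : 0 < v) (i : Fin r)
    (F : Bool ⊕ (Fin r ⊕ Fin r) → ℝ) :
    ∑ x, selProb (incidentEdges (whiskerGraph r r)) α (whiskerVector r v u) x (rightEdge i) *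
      F x = leafProb r α v u * F (Sum.inl true) + F (Sum.inr (Sum.inr i)) := by
  simp [selProb, mem_incidentEdges, weightSum_whiskerVector hα, Fintype.sum_sum_type,
    vertexWeight_whiskerWeight_true hα, vertexWeight_whiskerWeight_right hα, rightEdge,
    whiskerVector, leafProb, (Real.rpow_pos_of_pos hv α).ne']

theorem gainMatrix_mulVec_whiskerMode (hr : 1 ≤ r) (hα : 1 < α) (hu : 0 < u)
    (heq : IsEquilibrium (graphLaw (whiskerGraph r r)) α (whiskerVector r v u)) :
    ∀ e, (gainMatrix (incidentEdges (whiskerGraph r r)) α (whiskerVector r v u)).mulVec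
      (fun f => whiskerVector r v u f * whiskerMode r (leafProb r α v u) f) e =
      α * (r + 1) * leafProb r α v u / (1 + leafProb r α v u) *
        (whiskerVector r v u e * whiskerMode r (leafProb r α v u) e) := by
  have hα0 : α ≠ 0 := by linarith
  obtain ⟨hv, hcentre, hleaf⟩ := (isEquilibrium_whiskerVector_iff hr hα0 hu).mp heq
  have hp := leafProb_nonneg (r := r) (α := α) hv.le hu.le
  have hfalse := selMean_whiskerVector_false (r := r) hα0 hv.le hu
  have htrue := selMean_whiskerVector_true (r := r) hα0 hv.le hu
  simp only [gainMatrix_mulVec_mul hα heq.1.1, card_whiskerGraph]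
  simp only [forall_whiskerGraph_edge_iff, sum_selProb_centreEdge_mul hα0 hv.le hu,
    sum_selProb_leftEdge_mul hα0 hv, sum_selProb_rightEdge_mul hα0 hv,
    selMean_whiskerVector_left hα0 hv, selMean_whiskerVector_right hα0 hv, hfalse, htrue,
    whiskerMode, whiskerVector_centreEdge, whiskerVector_leftEdge, whiskerVector_rightEdge,
    Finset.sum_const, Finset.card_univ, Fintype.card_fin, nsmul_eq_mul, mul_one]
  have hq : 0 < 1 - r * leafProb r α v u := hcentre ▸ by positivity
  set p := leafProb r α v u
  have hu' : u = (1 - r * p) / (r + 1) := by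
    rw [← hcentre]
    field_simp
  have hv' : v = (1 + p) / (2 * (r + 1)) := by
    rw [← hleaf]
    field_simp
  rw [hu', hv']
  refine ⟨?_, fun _ => ?_, fun _ => ?_⟩ <;> field_simp <;> ring

theorem isLinearlyStable_whiskerVector_iff (hr : 1 ≤ r) (hα : 1 < α) (hu : 0 < u)
    (heq : IsEquilibrium (graphLaw (whiskerGraph r r)) α (whiskerVector r v u)) :
    IsLinearlyStable (graphLaw (whiskerGraph r r)) α (whiskerVector r v u) ↔
      α * (r + 1) * leafProb r α v u < 1 + leafProb r α v u := by
  refine ⟨fun h => ?_, isLinearlyStable_whiskerVector hr hα hu heq⟩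
  have hmode := gainMatrix_mulVec_whiskerMode hr hα hu heq
  obtain ⟨hv, -⟩ := (isEquilibrium_whiskerVector_iff hr (by linarith) hu).mp heq
  have hp := leafProb_nonneg (r := r) (α := α) hv.le hu.le
  rw [graphLaw_eq_incLaw, isLinearlyStable_incLaw_iff hα] at h
  have hne : (fun f => whiskerVector r v u f * whiskerMode r (leafProb r α v u) f) ≠ 0 :=
    fun h0 => hv.ne' (by simpa [whiskerMode] using congrFun h0 (leftEdge ⟨0, hr⟩))
  have hlt := h.2 _ (isEigenvalue_of_mulVec hne hmode)
  rwa [Complex.ofReal_re, div_lt_one (by linarith)] at hlt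

theorem whiskerPair_mem_stableEquilibria_iff {t : ℝ} (hr : 1 ≤ r) (hα : 1 < α)
    (ht : t ∈ ratioRoots (r + 1) α) :
    whiskerVector r (whiskerPair r t).1 (whiskerPair r t).2 ∈
      stableEquilibria (whiskerGraph r r) α ↔ t < ratioMin (r + 1) α := by
  have ht0 : 0 < t := ht.1
  have hα0 : α ≠ 0 := by linarith
  obtain ⟨hu, heq⟩ := (setOf_whiskerVector_mem_equilibria hr hα0).ge ⟨t, ht, rfl⟩
  refine (isLinearlyStable_whiskerVector_iff hr hα hu heq).trans ?_
  have hpair : (whiskerPair r t).1 = t * (whiskerPair r t).2 := by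
    simp [whiskerPair, div_eq_mul_inv]
  have hden : 0 < 1 + r * t ^ α := by positivity
  have hroot : (r + 1) * t ^ α - 2 * t + 1 = 0 := ht.2
  rw [hpair, leafProb_mul ht0.le hu, lt_ratioMin_iff (by positivity) hα ht0.le,
    Real.rpow_sub_one ht0.ne', one_add_div hden.ne', mul_div_assoc',
    div_lt_div_iff_of_pos_right hden, mul_div_assoc', div_lt_iff₀ ht0,
    show 1 + r * t ^ α + t ^ α = 2 * t by linarith]

end WhiskerStability

/-! ### The phase transition -/

section PhaseTransition

variable {r : ℕ}

theorem whiskerPair_fst_lt_snd {t : ℝ} (ht : 0 ≤ t) (h1 : t < 1) :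
    (whiskerPair r t).1 < (whiskerPair r t).2 :=
  div_lt_div_of_pos_right h1 (by positivity)

theorem strictAntiOn_whiskerPair_snd (hr : 1 ≤ r) :
    StrictAntiOn (fun t => (whiskerPair r t).2) (Set.Ici 0) := by
  intro s (hs : 0 ≤ s) t _ hst
  have : (0 : ℝ) < r := by exact_mod_cast hr
  refine one_div_lt_one_div_of_lt (by positivity) ?_
  gcongr

theorem tendsto_whiskerPair_snd {τ : ℝ → ℝ} (h : Tendsto τ atTop (𝓝 (1 / 2))) :
    Tendsto (fun α => (whiskerPair r (τ α)).2) atTop (𝓝 (1 / ((r : ℝ) + 1))) := by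
  have hlim : (r : ℝ) + 1 = 1 + 2 * r * (1 / 2) := by ring
  rw [hlim]
  exact tendsto_const_nhds.div ((h.const_mul (2 * (r : ℝ))).const_add 1) (by positivity)

theorem setOf_whiskerVector_mem_equilibria_eq_pair {α t t' : ℝ} (hr : 1 ≤ r) (hα : 1 < α)
    (h : ratioRoots (r + 1) α = {t, t'}) (hlt : t < ratioMin (r + 1) α)
    (hlt' : ratioMin (r + 1) α < t') :
    {q : ℝ × ℝ | 0 < q.2 ∧ whiskerVector r q.1 q.2 ∈ equilibria (whiskerGraph r r) α} =
        {whiskerPair r t, whiskerPair r t'} ∧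
      whiskerPair r t ≠ whiskerPair r t' ∧
      (whiskerPair r t).1 < (whiskerPair r t).2 ∧ (whiskerPair r t').1 < (whiskerPair r t').2 ∧
      whiskerVector r (whiskerPair r t).1 (whiskerPair r t).2 ∈
        stableEquilibria (whiskerGraph r r) α ∧
      whiskerVector r (whiskerPair r t').1 (whiskerPair r t').2 ∉
        stableEquilibria (whiskerGraph r r) α := by
  have hc : (2 : ℝ) ≤ r + 1 := by
    have : (1 : ℝ) ≤ r := by exact_mod_cast hr
    linarith
  have ht : t ∈ ratioRoots (r + 1) α := h ▸ Set.mem_insert t {t'}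
  have ht' : t' ∈ ratioRoots (r + 1) α := h ▸ Set.mem_insert_of_mem t rfl
  refine ⟨?_, fun heq => ?_, whiskerPair_fst_lt_snd ht.1.le (lt_one_of_mem_ratioRoots hc hα ht),
    whiskerPair_fst_lt_snd ht'.1.le (lt_one_of_mem_ratioRoots hc hα ht'),
    (whiskerPair_mem_stableEquilibria_iff hr hα ht).mpr hlt,
    fun hst => hlt'.not_gt ((whiskerPair_mem_stableEquilibria_iff hr hα ht').mp hst)⟩
  · rw [setOf_whiskerVector_mem_equilibria hr (by linarith), h, Set.image_pair]
  · exact (strictAntiOn_whiskerPair_snd hr ht.1.le ht'.1.le (hlt.trans hlt')).ne'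
      (congrArg Prod.snd heq)

theorem whiskerVector_notMem_equilibria {α v u : ℝ} (hr : 1 ≤ r) (hα : 1 < α)
    (h : thresholdFun α < Real.log (((r : ℝ) + 1) / 2)) (hu : 0 < u) :
    whiskerVector r v u ∉ equilibria (whiskerGraph r r) α := fun hmem => by
  have hq : (v, u) ∈ {q : ℝ × ℝ |
      0 < q.2 ∧ whiskerVector r q.1 q.2 ∈ equilibria (whiskerGraph r r) α} := ⟨hu, hmem⟩
  rwa [setOf_whiskerVector_mem_equilibria hr (by linarith),
    ratioRoots_eq_empty (by positivity) hα h, Set.image_empty] at hq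

theorem exists_whisker_branches {a : ℝ} (hr : 1 ≤ r) (ha : 1 < a)
    (h : ∀ α, a < α → Real.log (((r : ℝ) + 1) / 2) < thresholdFun α) :
    ∃ v u v' u' : ℝ → ℝ,
      (∀ α : ℝ, a < α →
        {q : ℝ × ℝ | 0 < q.2 ∧ whiskerVector r q.1 q.2 ∈ equilibria (whiskerGraph r r) α} =
          {(v α, u α), (v' α, u' α)} ∧
        (v α, u α) ≠ (v' α, u' α) ∧
        v α < u α ∧ v' α < u' α ∧
        whiskerVector r (v α) (u α) ∈ stableEquilibria (whiskerGraph r r) α ∧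
        whiskerVector r (v' α) (u' α) ∉ stableEquilibria (whiskerGraph r r) α) ∧
      StrictMonoOn u (Set.Ioi a) ∧
      Tendsto u atTop (𝓝 (1 / ((r : ℝ) + 1))) := by
  have hc : (2 : ℝ) ≤ r + 1 := by
    have : (1 : ℝ) ≤ r := by exact_mod_cast hr
    linarith
  obtain ⟨t, t', hroots, hanti, hlim⟩ := exists_ratioRoots_branches hc ha h
  have hpos : ∀ α, a < α → 0 < t α := fun α hα => by
    have ht : t α ∈ ratioRoots (r + 1) α := (hroots α hα).1 ▸ Set.mem_insert _ _
    exact ht.1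
  refine ⟨fun α => (whiskerPair r (t α)).1, fun α => (whiskerPair r (t α)).2,
    fun α => (whiskerPair r (t' α)).1, fun α => (whiskerPair r (t' α)).2, fun α hα => ?_,
    fun α hα β hβ hαβ => ?_, tendsto_whiskerPair_snd hlim⟩
  · obtain ⟨hset, hlt, hlt'⟩ := hroots α hα
    exact setOf_whiskerVector_mem_equilibria_eq_pair hr (ha.trans hα) hset hlt hlt'
  · exact strictAntiOn_whiskerPair_snd hr (hpos β hβ).le (hpos α hα).le (hanti hα hβ hαβ)

end PhaseTransition

/-! ### Stable allocations on forests -/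

section WhiskerAllocation

variable {r s : ℕ} {α ε n t v u : ℝ}

theorem isDominatedAllocation_whiskerWeight (hα : α ≠ 0) (hv : 0 < v) (hu : 0 < u)
    (hnu : 1 ≤ n * u) (hcentre : n * u = (1 - r * leafProb r α v u) + (1 - s * leafProb s α v u))
    (hleft : ∀ _ : Fin r, n * v = leafProb r α v u + 1)
    (hright : ∀ _ : Fin s, n * v = leafProb s α v u + 1)
    (hr : r * leafProb r α v u ≤ ε) (hs : s * leafProb s α v u ≤ ε) :
    IsDominatedAllocation (whiskerGraph r s) α n ε (whiskerWeight r s v u) := by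
  have hleaf : ∀ m, 0 ≤ leafProb m α v u := fun m => leafProb_nonneg hv.le hu.le
  have hε : 0 ≤ ε := (mul_nonneg r.cast_nonneg (hleaf r)).trans hr
  have hva : 0 < v ^ α := Real.rpow_pos_of_pos hv α
  have hdom : ∀ m : ℕ, m * leafProb m α v u ≤ ε → (1 - ε) * (u ^ α + m * v ^ α) ≤ u ^ α :=
    fun m hm => by
      rw [← le_div_iff₀ (by positivity), rpow_div_eq_one_sub_leafProb hv.le hu]
      linarith
  refine ⟨?_, whiskerWeight_eq_zero,
    (whiskerWeight_balance_iff hα hv hu).mpr ⟨hcentre, hleft, hright⟩, ?_⟩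
  · rintro ⟨x, y⟩
    refine (forall_whiskerGraph_adj_iff (P := fun x y => 1 ≤ n * whiskerWeight r s v u s(x, y))
      fun x y h => by rwa [Sym2.eq_swap]).mpr ⟨?_, fun i => ?_, fun i => ?_⟩ x y
    · rwa [whiskerWeight_centre]
    · rw [whiskerWeight_left, hleft i]
      linarith [hleaf r]
    · rw [whiskerWeight_right, hright i]
      linarith [hleaf s]
  · rintro ((_ | _) | i | i) -
    · refine ⟨Sum.inl true, (centreEdge r s).2, ?_⟩
      rw [vertexWeight_whiskerWeight_false hα, whiskerWeight_centre]
      exact hdom r hr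
    · refine ⟨Sum.inl false, (centreEdge r s).2.symm, ?_⟩
      rw [vertexWeight_whiskerWeight_true hα, Sym2.eq_swap, whiskerWeight_centre]
      exact hdom s hs
    · refine ⟨Sum.inl false, (leftEdge i).2.symm, ?_⟩
      rw [vertexWeight_whiskerWeight_left hα, Sym2.eq_swap, whiskerWeight_left]
      nlinarith
    · refine ⟨Sum.inl true, (rightEdge i).2.symm, ?_⟩
      rw [vertexWeight_whiskerWeight_right hα, Sym2.eq_swap, whiskerWeight_right]
      nlinarith

theorem leafProb_mul_le (ht : 0 ≤ t) (hu : 0 < u) : leafProb r α (t * u) u ≤ t ^ α := by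
  rw [leafProb_mul ht hu]
  have := Real.rpow_nonneg ht α
  exact div_le_self this (le_add_of_nonneg_right (by positivity))

theorem exists_leafProb_ratio (hα : 0 < α) (h : (r + s + 1) * (3 / 4 : ℝ) ^ α ≤ 1 / 2) :
    ∃ t ∈ Set.Icc (1 / 2 : ℝ) (3 / 4),
      t * ((1 - r * leafProb r α t 1) + (1 - s * leafProb s α t 1)) = leafProb r α t 1 + 1 := by
  have hcont : ∀ m, ContinuousOn (fun t => leafProb m α t 1) (Set.Icc (1 / 2) (3 / 4)) :=
    fun m => by
      have hpow : ContinuousOn (fun t : ℝ => t ^ α) (Set.Icc (1 / 2) (3 / 4)) :=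
        (Real.continuous_rpow_const hα.le).continuousOn
      refine hpow.div (by fun_prop) fun t ht => ?_
      have := Real.rpow_nonneg (one_half_pos.le.trans ht.1) α
      positivity
  have hnonneg : ∀ m t, 0 ≤ t → 0 ≤ leafProb m α t 1 := fun m t ht => leafProb_nonneg ht one_pos.le
  have hle : ∀ m, leafProb m α (3 / 4) 1 ≤ (3 / 4) ^ α := fun m => by
    simpa only [mul_one] using leafProb_mul_le (by norm_num : (0 : ℝ) ≤ 3 / 4) one_pos
  refine isPreconnected_Icc.intermediate_value₂ (a := 1 / 2) (b := 3 / 4) (by norm_num)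
    (by norm_num) (by fun_prop) (by fun_prop) ?_ ?_
  · have := hnonneg r (1 / 2) (by norm_num)
    have := mul_nonneg r.cast_nonneg this
    have := mul_nonneg s.cast_nonneg (hnonneg s (1 / 2) (by norm_num))
    linarith
  · have := mul_le_mul_of_nonneg_left (hle r) r.cast_nonneg
    have := mul_le_mul_of_nonneg_left (hle s) s.cast_nonneg
    have : (0 : ℝ) ≤ r * (3 / 4) ^ α := by positivity
    have : (0 : ℝ) ≤ s * (3 / 4) ^ α := by positivity
    linarith [hle r]

theorem exists_isDominatedAllocation_whiskerGraph (hrs : s = 0 ∨ s = r) (hα : 0 < α) (hn : 0 < n)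
    (hε : ε ≤ 1 / 2) (h : (r + s + 1) * (3 / 4 : ℝ) ^ α ≤ ε) :
    ∃ w, IsDominatedAllocation (whiskerGraph r s) α n ε w := by
  obtain ⟨t, ⟨ht, ht'⟩, heq⟩ := exists_leafProb_ratio hα (h.trans hε)
  have ht0 : 0 < t := by linarith
  set q := (1 - r * leafProb r α t 1) + (1 - s * leafProb s α t 1) with hq
  have hq1 : 1 ≤ q := by
    have := leafProb_nonneg (r := r) (α := α) ht0.le one_pos.le
    nlinarith
  have hu : 0 < q / n := by positivity
  have hnu : n * (q / n) = q := mul_div_cancel₀ q hn.ne'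
  have hscale : ∀ m, leafProb m α (t * (q / n)) (q / n) = leafProb m α t 1 := fun m => by
    simpa only [mul_one] using (leafProb_mul ht0.le hu).trans (leafProb_mul ht0.le one_pos).symm
  have hleaf : n * (t * (q / n)) = leafProb r α (t * (q / n)) (q / n) + 1 := by
    rw [mul_left_comm, hnu, heq, hscale]
  have hsmall : ∀ m : ℕ, (m : ℝ) ≤ r + s + 1 → m * leafProb m α (t * (q / n)) (q / n) ≤ ε :=
    fun m hm => calc
      m * leafProb m α (t * (q / n)) (q / n) ≤ (r + s + 1) * (3 / 4) ^ α :=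
        mul_le_mul hm ((leafProb_mul_le ht0.le hu).trans (Real.rpow_le_rpow ht0.le ht' hα.le))
          (leafProb_nonneg (by positivity) hu.le) (by positivity)
      _ ≤ ε := h
  refine ⟨_, isDominatedAllocation_whiskerWeight hα.ne' (mul_pos ht0 hu) hu (hnu.symm ▸ hq1)
    (by rw [hnu, hscale, hscale, hq]) (fun _ => hleaf) (fun i => ?_)
    (hsmall r (by linarith [Nat.cast_nonneg' (α := ℝ) s]))
    (hsmall s (by linarith [Nat.cast_nonneg' (α := ℝ) r]))⟩
  rcases hrs with rfl | rfl
  exacts [i.elim0, hleaf]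

theorem eventually_mul_rpow_le_inv_sq (C : ℝ) :
    ∀ᶠ α : ℝ in atTop, C * (3 / 4 : ℝ) ^ α ≤ (α ^ 2)⁻¹ := by
  have hlog : 0 < -Real.log (3 / 4) := neg_pos.mpr (Real.log_neg (by norm_num) (by norm_num))
  have hlim := (tendsto_rpow_mul_exp_neg_mul_atTop_nhds_zero 2 _ hlog).const_mul C
  rw [mul_zero] at hlim
  filter_upwards [hlim.eventually_le_const one_pos, eventually_gt_atTop 0] with α hα hpos
  rw [neg_neg, ← Real.rpow_def_of_pos (by norm_num), Real.rpow_two] at hα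
  rw [← one_div, le_div_iff₀ (by positivity)]
  linarith

theorem eventually_exists_isDominatedAllocation_whiskerGraph (hrs : s = 0 ∨ s = r) (hn : 0 < n) :
    ∀ᶠ α in atTop, ∃ w, IsDominatedAllocation (whiskerGraph r s) α n (α ^ 2)⁻¹ w := by
  filter_upwards [eventually_ge_atTop 2, eventually_mul_rpow_le_inv_sq (r + s + 1)] with α hα h
  refine exists_isDominatedAllocation_whiskerGraph hrs (by linarith) hn ?_ h
  rw [one_div]
  exact inv_anti₀ two_pos (by nlinarith)

end WhiskerAllocation

section Clusters

/-- A star with `r + 1` edges is a whisker graph without leaves at the second centre. -/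
def starIso (r : ℕ) : completeBipartiteGraph Unit (Fin (r + 1)) ≃g whiskerGraph r 0 where
  toFun x := match x with
    | Sum.inl _ => Sum.inl false
    | Sum.inr i => Fin.cases (Sum.inl true) (fun i => Sum.inr (Sum.inl i)) i
  invFun x := match x with
    | Sum.inl false => Sum.inl ()
    | Sum.inl true => Sum.inr 0
    | Sum.inr (Sum.inl i) => Sum.inr i.succ
    | Sum.inr (Sum.inr i) => i.elim0
  left_inv x := by
    rcases x with _ | i
    · rfl
    · induction i using Fin.cases <;> rfl
  right_inv x := by
    rcases x with (_ | _) | i | i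
    · rfl
    · rfl
    · rfl
    · exact i.elim0
  map_rel_iff' {x y} := by
    rcases x with _ | i <;> rcases y with _ | j
    · simp [whiskerGraph]
    · induction j using Fin.cases <;> simp [whiskerGraph]
    · induction i using Fin.cases <;> simp [whiskerGraph]
    · induction i using Fin.cases <;> induction j using Fin.cases <;> simp [whiskerGraph]

theorem exists_whiskerGraph_iso {W : Type*} {H : SimpleGraph W}
    (h : IsStar H ∨ IsSymmetricWhisker H) :
    ∃ r s : ℕ, (s = 0 ∨ s = r) ∧ Nonempty (whiskerGraph r s ≃g H) := by
  rcases h with ⟨m, hm, ⟨f⟩⟩ | ⟨r, -, hf⟩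
  · obtain ⟨r, rfl⟩ := Nat.exists_eq_add_of_le' hm
    exact ⟨r, 0, Or.inl rfl, ⟨(starIso r).symm.trans f⟩⟩
  · exact ⟨r, r, Or.inr rfl, hf⟩

theorem support_whiskerGraph (r s : ℕ) : (whiskerGraph r s).support = Set.univ := by
  rw [Set.eq_univ_iff_forall]
  rintro ((_ | _) | i | i)
  exacts [SimpleGraph.Adj.mem_support_left (centreEdge r s).2,
    SimpleGraph.Adj.mem_support_right (centreEdge r s).2,
    SimpleGraph.Adj.mem_support_right (leftEdge i).2,
    SimpleGraph.Adj.mem_support_right (rightEdge i).2]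

variable {V W : Type*} {G : SimpleGraph V}

theorem exists_map_eq_spanningCoe {K : SimpleGraph W} {H : G.Subgraph} (φ : K ≃g H.coe) :
    ∃ f : W ↪ V, Set.range f = H.verts ∧ K.map f = H.spanningCoe := by
  refine ⟨φ.toEquiv.toEmbedding.trans (Function.Embedding.subtype _), ?_, ?_⟩
  · rw [Function.Embedding.coe_trans, Set.range_comp]
    simp
  · ext x y
    simp only [SimpleGraph.map_adj, SimpleGraph.Subgraph.spanningCoe_adj]
    constructor
    · rintro ⟨a, b, hab, rfl, rfl⟩
      exact φ.map_rel_iff.mpr hab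
    · intro h
      obtain ⟨a, ha⟩ := φ.surjective ⟨x, h.fst_mem⟩
      obtain ⟨b, hb⟩ := φ.surjective ⟨y, h.snd_mem⟩
      refine ⟨a, b, φ.map_rel_iff.mp ?_, congrArg Subtype.val ha, congrArg Subtype.val hb⟩
      rwa [ha, hb]

theorem support_spanningCoe_eq_verts {H : G.Subgraph}
    (h : IsStar H.coe ∨ IsSymmetricWhisker H.coe) : H.spanningCoe.support = H.verts := by
  obtain ⟨r, s, -, ⟨φ⟩⟩ := exists_whiskerGraph_iso h
  obtain ⟨f, hf, hmap⟩ := exists_map_eq_spanningCoe φ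
  rw [← hmap, SimpleGraph.support_map, support_whiskerGraph, Set.image_univ, hf]

theorem eventually_exists_isDominatedAllocation_spanningCoe [Fintype V] {H : G.Subgraph} {n : ℝ}
    (h : IsStar H.coe ∨ IsSymmetricWhisker H.coe) (hn : 0 < n) :
    ∀ᶠ α in atTop, ∃ w, IsDominatedAllocation H.spanningCoe α n (α ^ 2)⁻¹ w := by
  obtain ⟨r, s, hrs, ⟨φ⟩⟩ := exists_whiskerGraph_iso h
  obtain ⟨f, -, hmap⟩ := exists_map_eq_spanningCoe φ
  filter_upwards [eventually_exists_isDominatedAllocation_whiskerGraph hrs hn,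
    eventually_ne_atTop 0] with α ⟨w, hw⟩ hα
  exact ⟨_, hmap ▸ hw.map f hα⟩

theorem eventually_exists_stable_allocation [Fintype V] [Nonempty V] {k : ℕ}
    {H : Fin k → G.Subgraph} (hcover : ⋃ j, (H j).verts = Set.univ)
    (hdisj : ∀ i j, i ≠ j → Disjoint (H i).verts (H j).verts)
    (hshape : ∀ j, IsStar (H j).coe ∨ IsSymmetricWhisker (H j).coe) :
    ∀ᶠ α in atTop, ∃ w : Sym2 V → ℝ, (∀ e, (∃ j, e ∈ (H j).edgeSet) → 0 < w e) ∧
      (∀ e, (¬ ∃ j, e ∈ (H j).edgeSet) → w e = 0) ∧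
      (fun e : G.edgeSet => w e) ∈ stableEquilibria G α := by
  have hn : (0 : ℝ) < Fintype.card V := by exact_mod_cast Fintype.card_pos
  have hsupp : ∀ j, (H j).spanningCoe.support = (H j).verts := fun j =>
    support_spanningCoe_eq_verts (hshape j)
  filter_upwards [eventually_all.mpr fun j =>
      eventually_exists_isDominatedAllocation_spanningCoe (hshape j) hn,
    eventually_gt_atTop 1, eventually_gt_atTop (4 * (Fintype.card V : ℝ))] with α hw hα hlarge
  choose w hw using hw
  have hsum := IsDominatedAllocation.iSup hw fun i j hij => by
    simpa only [hsupp] using hdisj i j hij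
  have hedge : ∀ e, e ∈ (⨆ j, (H j).spanningCoe).edgeSet ↔ ∃ j, e ∈ (H j).edgeSet := by
    simp [SimpleGraph.edgeSet_iSup]
  refine ⟨_, fun e he => hsum.pos hn.le ((hedge e).mpr he),
    fun e he => hsum.eq_zero e (mt (hedge e).mp he),
    hsum.isLinearlyStable (iSup_le fun j => (H j).spanningCoe_le) ?_ hα (by positivity) ?_⟩
  · rw [Set.eq_univ_iff_forall]
    intro x
    obtain ⟨j, hj⟩ := Set.mem_iUnion.mp (hcover ▸ Set.mem_univ x)
    rw [← hsupp] at hj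
    exact SimpleGraph.support_mono (le_iSup _ j) hj
  · have : 0 < α := one_pos.trans hα
    rw [mul_right_comm, ← div_eq_mul_inv, div_lt_one (by positivity)]
    nlinarith

theorem eventually_admitsStableAllocation [Fintype V] [Nonempty V] {k : ℕ}
    {H : Fin k → G.Subgraph} (h : IsSymmetricWhiskerForest G H) :
    ∀ᶠ α in atTop, AdmitsStableAllocation G α H := by
  obtain ⟨⟨-, -, -, hcover, hdisj⟩, hshape⟩ := h
  filter_upwards [eventually_exists_stable_allocation hcover hdisj hshape]
    with α ⟨w, hpos, hzero, hstable⟩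
  exact ⟨fun e => w e, fun e => hpos e, fun e => hzero e, Or.inl hstable⟩

theorem eventually_nonempty_stableEquilibria [Fintype V] (h : IsSymmetricWhisker G) :
    ∀ᶠ α in atTop, (stableEquilibria G α).Nonempty := by
  obtain ⟨r, hr, ⟨φ⟩⟩ := h
  have : Nonempty V := ⟨φ (Sum.inl false)⟩
  filter_upwards [eventually_exists_stable_allocation (H := fun _ : Fin 1 => (⊤ : G.Subgraph))
    (by simp [Set.iUnion_const]) (fun i j hij => absurd (Subsingleton.elim i j) hij)
    fun _ => Or.inr ⟨r, hr, ⟨φ.trans SimpleGraph.Subgraph.topIso.symm⟩⟩] with α ⟨w, _, _, hw⟩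
  exact ⟨_, hw⟩

end Clusters

end WARM

end

theorem theorem11 :
    (∀ r : ℕ, 1 ≤ r → ∃ a : ℝ, 1 < a ∧
      -- the explicit characterisation of the threshold `a = α(r)`
      WARM.thresholdFun a = Real.log ((1 + (r : ℝ)) / 2) ∧
      (∀ β : ℝ, 1 < β → WARM.thresholdFun β = Real.log ((1 + (r : ℝ)) / 2) → β = a) ∧
      (2 * (1 - 1 / a)) ^ (a - 1) = a / 2 * ((r : ℝ) + 1) ∧
      -- above the threshold: two equilibria, of which exactly the first is linearly stable
      (∃ v u v' u' : ℝ → ℝ,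
        (∀ α : ℝ, a < α →
          {q : ℝ × ℝ | 0 < q.2 ∧ WARM.whiskerVector r q.1 q.2 ∈
              WARM.equilibria (WARM.whiskerGraph r r) α} = {(v α, u α), (v' α, u' α)} ∧
          (v α, u α) ≠ (v' α, u' α) ∧
          v α < u α ∧ v' α < u' α ∧
          WARM.whiskerVector r (v α) (u α) ∈
            WARM.stableEquilibria (WARM.whiskerGraph r r) α ∧
          WARM.whiskerVector r (v' α) (u' α) ∉
            WARM.stableEquilibria (WARM.whiskerGraph r r) α) ∧
        StrictMonoOn u (Set.Ioi a) ∧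
        Tendsto u atTop (𝓝 (1 / ((r : ℝ) + 1)))) ∧
      -- below the threshold: none
      (∀ α : ℝ, 1 < α → α < a → ∀ v u : ℝ, 0 < u →
        WARM.whiskerVector r v u ∉ WARM.equilibria (WARM.whiskerGraph r r) α)) ∧
    -- every symmetric whisker graph has a linearly stable equilibrium for large exponents
    (∀ (V : Type*) [Fintype V] (G : SimpleGraph V), WARM.IsSymmetricWhisker G →
      ∃ a : ℝ, 1 < a ∧ ∀ α : ℝ, a < α → (WARM.stableEquilibria G α).Nonempty) ∧
    -- every symmetric whisker-forest admits a stable allocation for large exponents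
    (∀ (V : Type*) [Fintype V] [Nonempty V] (G : SimpleGraph V) (k : ℕ)
      (H : Fin k → G.Subgraph), WARM.IsSymmetricWhiskerForest G H →
      ∃ a : ℝ, 1 < a ∧ ∀ α : ℝ, a < α → WARM.AdmitsStableAllocation G α H) := by
  refine ⟨fun r hr => ?_, fun V _ G hG => ?_, fun V _ _ G k H hH => ?_⟩
  · rw [add_comm (1 : ℝ)]
    have hc : (2 : ℝ) ≤ r + 1 := by exact_mod_cast Nat.succ_le_succ hr
    obtain ⟨a, ha, hat, habove, hbelow⟩ :=
      WARM.exists_threshold (Real.log_nonneg ((one_le_div two_pos).mpr hc))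
    exact ⟨a, ha, hat,
      fun β hβ h => le_antisymm (not_lt.mp fun hlt => (habove β hlt).ne' h)
        (not_lt.mp fun hlt => (hbelow β hβ hlt).ne h),
      WARM.rpow_eq_of_thresholdFun_eq ha (by positivity) hat,
      WARM.exists_whisker_branches hr ha habove,
      fun α h1 hα _ _ hu => WARM.whiskerVector_notMem_equilibria hr h1 (hbelow α h1 hα) hu⟩
  · exact (atTop_basis_Ioi' (1 : ℝ)).eventually_iff.mp
      (WARM.eventually_nonempty_stableEquilibria hG)
  · exact (atTop_basis_Ioi' (1 : ℝ)).eventually_iff.mp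
      (WARM.eventually_admitsStableAllocation hH)
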